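/- **Definitions.** All graphs are finite, simple and connected. $P_k$ is the path on $k$ nodes, and a graph is $P_k$-free if it does not contain $P_k$ as an induced subgraph. Let $\ell\ge 1$. In an $n$-node graph $G=(V,E)$ whose nodes carry pairwise distinct identifiers from a set $\{0,\dots,M-1\}$ with $M\ge n$, a certificate assignment of size $s$ gives each node $u$ a bit string $c(u)\in\{0,1\}^s$. The distance-$\ell$ view of $u$ consists of the identifier of $u$, the pairs $(\mathsf{id}(v),c(v))$ of all nodes $v$ at distance at most $\ell$ from $u$, and the edges of $G$ between these nodes (given by the identifiers of their endpoints). A proof-labeling scheme of locality $\ell$ and size $s$ (a $\mathsf{PLS}_\ell$ of size $s$) for $P_k$-freeness of $n$-node graphs is a function $\mathcal A$ from views to $\{\mathsf{Accept},\mathsf{Reject}\}$ (it may depend on $n$ and $M$) such that for every connected $n$-node graph $G$ with such identifiers: if $G$ is $P_k$-free, then for some certificate assignment of size $s$ every node outputs $\mathsf{Accept}$ on its view; if $G$ is not $P_k$-free, then for every certificate assignment of size $s$ at least one node outputs $\mathsf{Reject}$. **Theorem.** Let $\ell$, $d$ and $k$ be positive integers such that either $d\le 2$ and $k\ge 4d\ell+7d$,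 or $d\ge 3$ and $k\ge 4d\ell+4d$. Then every $\mathsf{PLS}_\ell$ for $P_k$-freeness requires certificates of size $\tilde\Omega(n^{2-1/d})$. That is, there are $C>0$, $a\in\mathbb N$ and $n_0$, depending only on $\ell,d,k$, such that for all $n\ge n_0$ and all $M\ge n$, every $\mathsf{PLS}_\ell$ for $P_k$-freeness of $n$-node graphs with identifiers from $\{0,\dots,M-1\}$ has size $$ s\;\ge\; C\,\frac{n^{2-1/d}}{(\log n)^a}. $$ -/

import Mathlib

/-- `G` is `P_k`-free: the path on `k` vertices is not an induced subgraph of `G`. -/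
def PathFree {V : Type} (k : ℕ) (G : SimpleGraph V) : Prop :=
  ¬ (SimpleGraph.pathGraph k).IsIndContained G

/-- A certificate of size `s`: a bit string of length `s`. -/
abbrev Certificate (s : ℕ) : Type := Fin s → Bool

/-- What a node may use in order to decide: its own identifier, the identifiers and certificates of
the nodes of its ball (its own certificate is the one listed next to its own identifier), and the
edges of the graph inside the ball, written as pairs of identifiers. -/
structure LocalView (s : ℕ) where
  center : ℕ
  labels : Set (ℕ × Certificate s)
  edges : Set (ℕ × ℕ)

/-- The ball of radius `ℓ` around `u`; `edist` is `⊤` between different components. -/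
def hopBall {V : Type} (G : SimpleGraph V) (ℓ : ℕ) (u : V) : Set V :=
  {v | G.edist u v ≤ (ℓ : ℕ∞)}

/-- The view at distance `ℓ` of the node `u` in `G`, under the identifiers `ident` and the
certificates `c`. -/
def localView {V : Type} {s : ℕ} (G : SimpleGraph V) (ident : V → ℕ) (c : V → Certificate s)
    (ℓ : ℕ) (u : V) : LocalView s where
  center := ident u
  labels := {p | ∃ v ∈ hopBall G ℓ u, p = (ident v, c v)}
  edges := {p | ∃ v ∈ hopBall G ℓ u, ∃ w ∈ hopBall G ℓ u, G.Adj v w ∧ p = (ident v, ident w)}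

/-- A verification algorithm, as a function from views to outputs; `true` means "accept". -/
abbrev Verifier (s : ℕ) : Type := LocalView s → Bool

/-- The verifier `A`, run with locality `ℓ` on certificates of size `s`, certifies the property `P`
on all connected graphs with `n` nodes and distinct identifiers from `{0, …, M - 1}`:
if `P G` holds, some certificate assignment is accepted by all nodes, and if it fails, every
certificate assignment is rejected by at least one node. -/
def Certifies (P : ∀ V : Type, SimpleGraph V → Prop) (ℓ n M s : ℕ) (A : Verifier s) : Prop :=
  ∀ (V : Type) [Fintype V] (G : SimpleGraph V) (ident : V → ℕ),
    Fintype.card V = n → G.Connected → Function.Injective ident → (∀ v, ident v < M) →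
      (P V G → ∃ c : V → Certificate s, ∀ u, A (localView G ident c ℓ u) = true) ∧
      (¬ P V G → ∀ c : V → Certificate s, ∃ u, A (localView G ident c ℓ u) = false)

/-- There is a proof-labeling scheme of locality `ℓ` and size `s` for `P`, on connected graphs with
`n` nodes and identifiers from `{0, …, M - 1}`. -/
def HasPLS (P : ∀ V : Type, SimpleGraph V → Prop) (ℓ n M s : ℕ) : Prop :=
  ∃ A : Verifier s, Certifies P ℓ n M s A

/-- Every proof-labeling scheme of locality `ℓ` for `P` has certificates of size `Ω̃(g n)`: up to a
constant factor and a power of `log n`, its size on `n`-node graphs is at least `g n` for all large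
`n`, for every identifier space that has room for `n` distinct identifiers. -/
def RequiresCertificateSize (P : ∀ V : Type, SimpleGraph V → Prop) (ℓ : ℕ) (g : ℕ → ℝ) : Prop :=
  ∃ C : ℝ, 0 < C ∧ ∃ a : ℕ, ∀ᶠ n : ℕ in Filter.atTop, ∀ M : ℕ, n ≤ M → ∀ s : ℕ,
    HasPLS P ℓ n M s → C * g n / Real.log n ^ a ≤ (s : ℝ)

/-!
A proof-labeling scheme decides disjointness nondeterministically. Take graphs `G x y` in which the
set `x` is visible only on one side and `y` only on the other, with the two sides further than `2ℓ`
apart, such that `G x y` is `P_k`-free exactly when `x` and `y` are disjoint. The certificates that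
make `G x xᶜ` accepted must differ on the vertices between the sides for different `x`, as otherwise
certificates of two such graphs could be glued into certificates of some `G x x'ᶜ` with an induced
`P_k`. So the number of possible elements is at most the size of the certificates times the number
of separating vertices.

The elements are the pairs of words of `d` digits below `q`. The vertices sit at the `k` positions
of a path, and a pair of words is spelled by choosing one vertex per position. A vertex on a side
stores a full word, and the vertices that store there the two words of a pair missing from `x`, or
from `y`, are adjacent. A vertex in between stores a single digit, so that `k * q` vertices separate
the sides of a graph on about `q ^ d` vertices, and `q ^ (2 * d)` pairs give certificates of size
`q ^ (2 * d - 1)`. A first bridge between the sides carries one digit of both words, and each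
further digit is carried by a run in the opposite direction to the previous one.

Two vertices that store different values of a digit are adjacent if their layers are equal or
consecutive, so an induced path through all positions in order spells the same pair of words on both
sides, and this pair has to lie in `x` and in `y`. That every induced path on `k` vertices visits
the positions in order rests on a counting argument: positions come alone or in blocks of two, and a
block is a clique, hence contains at most as many vertices of the path as it has positions.
-/

section LocalViews

variable {V : Type} {G G' : SimpleGraph V}

lemma mem_hopBall_iff_exists_walk {ℓ : ℕ} {u v : V} :
    v ∈ hopBall G ℓ u ↔ ∃ p : G.Walk u v, p.length ≤ ℓ := by
  constructor
  · intro (hv : G.edist u v ≤ ℓ)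
    obtain ⟨p, hp⟩ := SimpleGraph.exists_walk_of_edist_ne_top
      (ne_top_of_le_ne_top (ENat.natCast_ne_top ℓ) hv)
    exact ⟨p, by rwa [← hp, Nat.cast_le] at hv⟩
  · rintro ⟨p, hp⟩
    exact (SimpleGraph.edist_le p).trans (by exact_mod_cast hp)

lemma le_add_mul_of_mem_hopBall {φ : V → ℕ} {c : ℕ} (hφ : ∀ u v, G.Adj u v → φ v ≤ φ u + c)
    {ℓ : ℕ} {u v : V} (hv : v ∈ hopBall G ℓ u) : φ v ≤ φ u + c * ℓ := by
  obtain ⟨p, hp⟩ := mem_hopBall_iff_exists_walk.1 hv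
  suffices φ v ≤ φ u + c * p.length from this.trans (by gcongr)
  clear hv hp
  induction p with
  | nil => simp
  | cons h p ih =>
    have := hφ _ _ h
    rw [SimpleGraph.Walk.length_cons, mul_add]
    omega

lemma hopBall_subset_of_agree {S : Set V} {ℓ : ℕ} {u : V} (hS : hopBall G ℓ u ⊆ S)
    (hadj : ∀ v ∈ S, ∀ w ∈ S, G.Adj v w → G'.Adj v w) : hopBall G ℓ u ⊆ hopBall G' ℓ u := by
  classical
  intro v hv
  obtain ⟨p, hp⟩ := mem_hopBall_iff_exists_walk.1 hv
  have hsupport : ∀ w ∈ p.support, w ∈ S := fun w hw =>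
    hS (mem_hopBall_iff_exists_walk.2
      ⟨p.takeUntil w hw, (p.length_takeUntil_le_length hw).trans hp⟩)
  have hedges : ∀ e ∈ p.edges, e ∈ G'.edgeSet := by
    rintro ⟨w, w'⟩ he
    exact hadj w (hsupport w (p.fst_mem_support_of_mem_edges he))
      w' (hsupport w' (p.snd_mem_support_of_mem_edges he)) (p.adj_of_mem_edges he)
  exact mem_hopBall_iff_exists_walk.2 ⟨p.transfer G' hedges, by rwa [p.length_transfer]⟩

lemma localView_eq_of_agree {S : Set V} {ℓ s : ℕ} {u : V} (ident : V → ℕ)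
    {c c' : V → Certificate s} (hS : hopBall G ℓ u ⊆ S) (hS' : hopBall G' ℓ u ⊆ S)
    (hadj : ∀ v ∈ S, ∀ w ∈ S, (G.Adj v w ↔ G'.Adj v w)) (hc : ∀ v ∈ S, c v = c' v) :
    localView G ident c ℓ u = localView G' ident c' ℓ u := by
  have hball : hopBall G ℓ u = hopBall G' ℓ u :=
    (hopBall_subset_of_agree hS fun v hv w hw => (hadj v hv w hw).1).antisymm
      (hopBall_subset_of_agree hS' fun v hv w hw => (hadj v hv w hw).2)
  rw [hball] at hS
  simp only [localView, hball, LocalView.mk.injEq, true_and]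
  constructor
  · ext p
    exact exists_congr fun v => and_congr_right fun hv => by rw [hc v (hS hv)]
  · ext p
    exact exists_congr fun v => and_congr_right fun hv => exists_congr fun w =>
      and_congr_right fun hw => by rw [hadj v (hS hv) w (hS hw)]

end LocalViews

/-- A family of connected graphs on `V` in which the property `P` tests the disjointness of two sets
`x` and `y`. The graph depends on `x` only at level `0` of `level` and on `y` only from level `top`
on, and an edge joins levels that differ by at most two: that is, `level` is twice a distance to the
side of `x`, which leaves room for half-integral distances. -/
structure DisjointnessGadget (P : ∀ V : Type, SimpleGraph V → Prop) (V ι : Type) where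
  graph : Set ι → Set ι → SimpleGraph V
  level : V → ℕ
  top : ℕ
  connected : ∀ x y, (graph x y).Connected
  level_le : ∀ {x y u v}, (graph x y).Adj u v → level v ≤ level u + 2
  adj_iff_of_pos : ∀ {u v}, 0 < level u → 0 < level v →
    ∀ x x' y, (graph x y).Adj u v ↔ (graph x' y).Adj u v
  adj_iff_of_lt_top : ∀ {u v}, level u < top → level v < top →
    ∀ x y y', (graph x y).Adj u v ↔ (graph x y').Adj u v
  property_iff : ∀ x y, P V (graph x y) ↔ Disjoint x y

namespace DisjointnessGadget

variable {P : ∀ V : Type, SimpleGraph V → Prop} {V ι : Type} (Γ : DisjointnessGadget P V ι)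
  {ℓ s M : ℕ}

/-- The vertices that see neither set; only their certificates carry information across. -/
def separator : Set V := {v | 0 < Γ.level v ∧ Γ.level v < Γ.top}

/-- A view of radius `ℓ` spans at most `4ℓ` levels, so it misses one of the two sides. -/
lemma accepts_glue (hℓ : 4 * ℓ < Γ.top) {A : Verifier s} {ident : V → ℕ}
    {c c' : V → Certificate s} {x x' y y' : Set ι} (hcc' : Set.EqOn c c' Γ.separator)
    (hc : ∀ u, A (localView (Γ.graph x y') ident c ℓ u) = true)
    (hc' : ∀ u, A (localView (Γ.graph x' y) ident c' ℓ u) = true) (u : V) :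
    A (localView (Γ.graph x y) ident (fun v => if Γ.level v < Γ.top then c v else c' v) ℓ u)
      = true := by
  have hball_le : ∀ x y, ∀ v ∈ hopBall (Γ.graph x y) ℓ u, Γ.level v ≤ Γ.level u + 2 * ℓ :=
    fun x y v hv => le_add_mul_of_mem_hopBall (fun _ _ => Γ.level_le) hv
  have hle_ball : ∀ x y, ∀ v ∈ hopBall (Γ.graph x y) ℓ u, Γ.level u ≤ Γ.level v + 2 * ℓ :=
    fun x y v hv => le_add_mul_of_mem_hopBall (fun _ _ => Γ.level_le) <| by
      rwa [hopBall, Set.mem_ofPred_eq, SimpleGraph.edist_comm]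
  rcases Nat.lt_or_ge (Γ.level u + 2 * ℓ) Γ.top with hlow | hhigh
  · rw [← hc u]
    congr 1
    refine localView_eq_of_agree (S := {v | Γ.level v < Γ.top}) ident
      (fun v hv => (hball_le x y v hv).trans_lt hlow)
      (fun v hv => (hball_le x y' v hv).trans_lt hlow)
      (fun v hv w hw => Γ.adj_iff_of_lt_top hv hw x y y') fun v hv => if_pos hv
  · have hpos : ∀ x y, hopBall (Γ.graph x y) ℓ u ⊆ {v | 0 < Γ.level v} := fun x y v hv => by
      have := hle_ball x y v hv
      rw [Set.mem_ofPred_eq]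
      omega
    rw [← hc' u]
    congr 1
    refine localView_eq_of_agree ident (hpos x y) (hpos x' y)
      (fun v hv w hw => Γ.adj_iff_of_pos hv hw x x' y) fun v hv => ?_
    split_ifs with htop
    · exact hcc' ⟨hv, htop⟩
    · rfl

/-- The fooling-set argument: the certificates that the instances `(x, xᶜ)` leave on the separator
are pairwise different. -/
theorem card_le_of_hasPLS [Fintype V] [Fintype ι] [Fintype Γ.separator] (hℓ : 4 * ℓ < Γ.top)
    (hM : Fintype.card V ≤ M) (h : HasPLS P ℓ (Fintype.card V) M s) :
    Fintype.card ι ≤ s * Fintype.card Γ.separator := by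
  classical
  obtain ⟨A, hA⟩ := h
  let ident : V → ℕ := fun v => Fintype.equivFin V v
  have hA' := fun x y => hA V (Γ.graph x y) ident rfl (Γ.connected x y)
    (Fin.val_injective.comp (Fintype.equivFin V).injective) fun v => (Fin.is_lt _).trans_le hM
  choose c hc using fun x : Set ι => (hA' x xᶜ).1 ((Γ.property_iff x xᶜ).2 disjoint_compl_right)
  have hsub : ∀ x x', Set.EqOn (c x) (c x') Γ.separator → x ⊆ x' := by
    intro x x' hxx'
    rw [← disjoint_compl_right_iff, ← Γ.property_iff]
    by_contra hP
    obtain ⟨u, hu⟩ := (hA' x x'ᶜ).2 hP _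
    exact absurd (Γ.accepts_glue hℓ hxx' (hc x) (hc x') u) (by rw [hu]; exact Bool.false_ne_true)
  have hinj : Function.Injective fun x (v : Γ.separator) => c x v := fun x x' hxx' =>
    have heq : Set.EqOn (c x) (c x') Γ.separator := fun v hv => congrFun hxx' ⟨v, hv⟩
    (hsub x x' heq).antisymm (hsub x' x heq.symm)
  have hcard := Fintype.card_le_of_injective _ hinj
  simp only [Fintype.card_set, Fintype.card_fun, Fintype.card_bool, Fintype.card_fin,
    ← pow_mul] at hcard
  exact (Nat.pow_le_pow_iff_right one_lt_two).1 hcard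

end DisjointnessGadget

lemma card_fiber_eq_of_forall_le {α β : Type*} [DecidableEq β] {s : Finset α} {f g : α → β}
    (h : ∀ c, (s.filter (f · = c)).card ≤ (s.filter (g · = c)).card) (c : β) :
    (s.filter (f · = c)).card = (s.filter (g · = c)).card := by
  set t := insert c (s.image f ∪ s.image g) with ht
  have hf : s.card = ∑ c ∈ t, (s.filter (f · = c)).card :=
    Finset.card_eq_sum_card_fiberwise fun i hi => by
      simp only [ht, Finset.coe_insert, Set.mem_insert_iff, Finset.mem_coe]
      exact .inr (Finset.mem_union_left _ (Finset.mem_image_of_mem _ hi))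
  have hg : s.card = ∑ c ∈ t, (s.filter (g · = c)).card :=
    Finset.card_eq_sum_card_fiberwise fun i hi => by
      simp only [ht, Finset.coe_insert, Set.mem_insert_iff, Finset.mem_coe]
      exact .inr (Finset.mem_union_right _ (Finset.mem_image_of_mem _ hi))
  exact (Finset.sum_eq_sum_iff_of_le fun c _ => h c).1 (hf.symm.trans hg) c
    (Finset.mem_insert_self _ _)

/-- `f 0, …, f (k - 1)` are, in this order, the vertices of an induced path of `G`; the other values
of `f` are irrelevant. -/
structure IsInducedPath {V : Type} (G : SimpleGraph V) (k : ℕ) (f : ℕ → V) : Prop where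
  inj : ∀ i < k, ∀ j < k, f i = f j → i = j
  adj : ∀ i < k, ∀ j < k, (G.Adj (f i) (f j) ↔ i + 1 = j ∨ j + 1 = i)

lemma not_pathFree_iff {V : Type} [Nonempty V] {k : ℕ} {G : SimpleGraph V} :
    ¬ PathFree k G ↔ ∃ f, IsInducedPath G k f := by
  rw [PathFree, not_not]
  constructor
  · rintro ⟨φ⟩
    classical
    refine ⟨fun i => if h : i < k then φ ⟨i, h⟩ else Classical.arbitrary V,
      fun i hi j hj h => ?_, fun i hi j hj => ?_⟩
    · simpa only [hi, hj, dif_pos, φ.injective.eq_iff, Fin.mk.injEq] using h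
    · simp only [hi, hj, dif_pos, φ.map_adj_iff, SimpleGraph.pathGraph_adj]
  · rintro ⟨f, hf⟩
    exact ⟨⟨⟨fun i => f i, fun i j h => Fin.ext (hf.inj _ i.2 _ j.2 h)⟩, fun {i j} => by
      rw [SimpleGraph.pathGraph_adj]
      exact hf.adj _ i.2 _ j.2⟩⟩

namespace IsInducedPath

variable {V : Type} {G : SimpleGraph V} {k : ℕ} {f : ℕ → V}

lemma reverse (hf : IsInducedPath G k f) : IsInducedPath G k (fun i => f (k - 1 - i)) where
  inj i hi j hj h := by
    have := hf.inj _ (by omega) _ (by omega) h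
    omega
  adj i hi j hj := by
    rw [hf.adj _ (by omega) _ (by omega)]
    omega

lemma ne (hf : IsInducedPath G k f) {i j : ℕ} (hi : i < k) (hj : j < k) (h : i ≠ j) : f i ≠ f j :=
  fun e => h (hf.inj i hi j hj e)

lemma adj_succ (hf : IsInducedPath G k f) {i : ℕ} (hi : i + 1 < k) : G.Adj (f i) (f (i + 1)) :=
  (hf.adj _ (by omega) _ hi).2 (.inl rfl)

lemma triangle_free (hf : IsInducedPath G k f) {i j l : ℕ} (hi : i < k) (hj : j < k) (hl : l < k)
    (hij : G.Adj (f i) (f j)) (hil : G.Adj (f i) (f l)) : ¬ G.Adj (f j) (f l) := by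
  rw [hf.adj _ hi _ hj] at hij
  rw [hf.adj _ hi _ hl] at hil
  rw [hf.adj _ hj _ hl]
  omega

lemma claw_free (hf : IsInducedPath G k f) {c i j l : ℕ} (hc : c < k) (hi : i < k) (hj : j < k)
    (hl : l < k) (hij : i ≠ j) (hil : i ≠ l) (hjl : j ≠ l)
    (hci : G.Adj (f c) (f i)) (hcj : G.Adj (f c) (f j)) : ¬ G.Adj (f c) (f l) := by
  rw [hf.adj _ hc _ hi] at hci
  rw [hf.adj _ hc _ hj] at hcj
  rw [hf.adj _ hc _ hl]
  omega

end IsInducedPath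

/-- The role of a position: it forms a block alone, or it is the first or the second position of a
block of two. -/
inductive Kind
  | single
  | first
  | second

/-- What is stored at a position of the path: the digits in `mask` of one of two words, the first
if `height` is even and the second if it is odd. The positions of heights `2 * i` and `2 * i + 1`
form the `i`-th layer between the two sides of the graph. -/
structure Slot where
  kind : Kind
  height : ℕ
  mask : Set ℕ

/-- `S` and `T` store the digit `τ` of the same word, on the same layer or on consecutive ones. -/
structure Slot.Compares (S T : Slot) (τ : ℕ) : Prop where
  parity : S.height % 2 = T.height % 2
  le : S.height ≤ T.height + 2
  ge : T.height ≤ S.height + 2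
  mem_left : τ ∈ S.mask
  mem_right : τ ∈ T.mask

lemma Slot.Compares.symm {S T : Slot} {τ : ℕ} (h : S.Compares T τ) : T.Compares S τ :=
  ⟨h.parity.symm, h.ge, h.le, h.mem_right, h.mem_left⟩

/-- A sequence of slots, of which the first `k` are used, in which words with `d` digits are carried
from layer `0` to layer `m + 1`. The two words are stored in full at the positions `a` and `a + 2`
on layer `0`, and at `b` and `b + 2` on layer `m + 1`. The fields `guarded` and `stable` restrict
the edges by which an induced path may leave a block of two. -/
structure Layout (k d m : ℕ) where
  slot : ℕ → Slot
  a : ℕ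
  b : ℕ
  a_lt : a + 2 < k
  b_lt : b + 3 < k
  kind_zero : (slot 0).kind = .single
  kind_last : (slot (k - 1)).kind = .single
  kind_left : ∀ t < 2, (slot (a + 2 * t)).kind = .first
  kind_right : ∀ t < 2, (slot (b + 2 * t)).kind = .second
  kind_right_hub : (slot (b + 3)).kind = .single
  second_succ_iff : ∀ p, (slot (p + 1)).kind = .second ↔ (slot p).kind = .first
  mask_single : ∀ p, (slot p).kind = .single → (slot p).mask = ∅
  height_left : ∀ t < 2, (slot (a + 2 * t)).height = t
  height_right : ∀ t < 2, (slot (b + 2 * t)).height = 2 * m + 2 + t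
  mem_mask_left : ∀ t < 2, ∀ τ < d, τ ∈ (slot (a + 2 * t)).mask
  mem_mask_right : ∀ t < 2, ∀ τ < d, τ ∈ (slot (b + 2 * t)).mask
  exists_slot : ∀ z < 2 * m + 2, ∀ τ < d, ∃ p < k, (slot p).height = z ∧ τ ∈ (slot p).mask
  not_compares_succ : ∀ p τ, ¬ (slot p).Compares (slot (p + 1)) τ
  guarded : ∀ j p τ, j + 2 < p → (slot j).kind = .second → (slot (j + 1)).kind = .first →
    (slot j).Compares (slot p) τ → (slot (p - 1)).kind = .single ∨ (slot (p + 1)).kind = .single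
  stable : ∀ j τ, (slot j).kind = .second → (slot (j + 1)).kind = .first →
    (slot j).Compares (slot (j + 2)) τ → (slot (j + 3)).kind = .first →
    (slot (j + 5)).kind = .single ∨
      j + 2 ≠ a ∧ (slot (j + 2)).mask.Subsingleton ∧ (slot (j + 2)).Compares (slot (j + 4)) τ

namespace Layout

variable {k d m : ℕ}

/-- Vertices that carry words over the alphabet `α`, arranged along the positions of `Λ`. Except at
the position `Λ.a`, where spare vertices may pile up, two vertices at the same position differ in a
digit that is stored there. -/
structure Placement (Λ : Layout k d m) (V α : Type) where
  pos : V → ℕ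
  word : V → Fin d → α
  pos_lt : ∀ v, pos v < k
  exists_ne : ∀ u v, pos u = pos v → pos u ≠ Λ.a → u ≠ v →
    ∃ τ : Fin d, ↑τ ∈ (Λ.slot (pos u)).mask ∧ word u τ ≠ word v τ

namespace Placement

variable {Λ : Layout k d m} {V α : Type} (Q : Λ.Placement V α)

/-- `u` and `v` store different values of a digit that their slots compare. -/
def Conflict (u v : V) : Prop :=
  ∃ τ : Fin d, (Λ.slot (Q.pos u)).Compares (Λ.slot (Q.pos v)) τ ∧ Q.word u τ ≠ Q.word v τ

/-- `u` and `v` store in full the two words of a pair that is missing from `x`, on the side of layer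
`0`, or from `y`, on the other side. -/
def Forbidden (x y : Set ((Fin d → α) × (Fin d → α))) (u v : V) : Prop :=
  Q.pos u = Λ.a ∧ Q.pos v = Λ.a + 2 ∧ (Q.word u, Q.word v) ∉ x ∨
    Q.pos u = Λ.b ∧ Q.pos v = Λ.b + 2 ∧ (Q.word u, Q.word v) ∉ y

/-- The graph of a placement: vertices at equal or consecutive positions are adjacent, and so are
vertices in conflict and the pairs that `x` and `y` forbid. -/
def graph (x y : Set ((Fin d → α) × (Fin d → α))) : SimpleGraph V :=
  .fromRel fun u v =>
    Q.pos u = Q.pos v ∨ Q.pos u + 1 = Q.pos v ∨ Q.Conflict u v ∨ Q.Forbidden x y u v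

end Placement

variable (Λ : Layout k d m)

lemma kind_a : (Λ.slot Λ.a).kind = .first :=
  Λ.kind_left 0 two_pos

/-- The block of the position `p`, named after its first position. -/
def block (p : ℕ) : ℕ :=
  match (Λ.slot p).kind with
  | .second => p - 1
  | _ => p

variable {Λ} {p r : ℕ}

lemma block_le : Λ.block p ≤ p := by
  unfold block
  split <;> omega

lemma le_block_add_one : p ≤ Λ.block p + 1 := by
  unfold block
  split <;> omega

lemma block_eq_self (h : (Λ.slot p).kind ≠ .second) : Λ.block p = p := by
  unfold block
  split
  · contradiction
  · rfl

lemma block_succ_of_first (h : (Λ.slot p).kind = .first) : Λ.block (p + 1) = p := by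
  simp only [block, (Λ.second_succ_iff p).2 h, Nat.add_sub_cancel]

lemma kind_eq_first_of_block_eq (h : Λ.block r = p) (hrp : r ≠ p) : (Λ.slot p).kind = .first := by
  have hr := Λ.le_block_add_one (p := r)
  have hr' := Λ.block_le (p := r)
  obtain rfl : r = p + 1 := by omega
  rw [← Λ.second_succ_iff]
  by_contra hne
  exact hrp ((block_eq_self hne).symm.trans h)

lemma eq_of_block_eq_of_single (h : (Λ.slot p).kind = .single) (hr : Λ.block r = Λ.block p) :
    r = p := by
  rw [block_eq_self (p := p) (by simp [h])] at hr
  by_contra hrp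
  simpa [h] using kind_eq_first_of_block_eq hr hrp

lemma succ_lt (hp : p < k) (h : (Λ.slot p).kind ≠ .single) : p + 1 < k := by
  by_contra hlast
  obtain rfl : p = k - 1 := by omega
  exact h Λ.kind_last

lemma exists_block_eq (hp : p < k) (h : (Λ.slot p).kind ≠ .single) :
    ∃ r < k, r ≠ p ∧ Λ.block r = Λ.block p := by
  rcases hkind : (Λ.slot p).kind with _ | _ | _
  · exact absurd hkind h
  · refine ⟨p + 1, succ_lt hp h, by omega, ?_⟩
    rw [block_succ_of_first hkind, block_eq_self (by simp [hkind])]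
  · obtain _ | r := p
    · exact absurd Λ.kind_zero h
    · have hfirst := (Λ.second_succ_iff r).1 hkind
      refine ⟨r, by omega, by omega, ?_⟩
      rw [block_succ_of_first hfirst, block_eq_self (by simp [hfirst])]

namespace Placement

variable {V α : Type} {Q : Λ.Placement V α} {x y : Set ((Fin d → α) × (Fin d → α))} {u v : V}

lemma Conflict.symm (h : Q.Conflict u v) : Q.Conflict v u :=
  let ⟨τ, hτ, hne⟩ := h
  ⟨τ, hτ.symm, hne.symm⟩

lemma adj_of_pos_eq (huv : u ≠ v) (h : Q.pos u = Q.pos v) : (Q.graph x y).Adj u v :=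
  ⟨huv, .inl (.inl h)⟩

lemma adj_of_pos_succ (h : Q.pos u + 1 = Q.pos v) : (Q.graph x y).Adj u v :=
  ⟨fun huv => by subst huv; omega, .inl (.inr (.inl h))⟩

lemma adj_of_conflict (huv : u ≠ v) (h : Q.Conflict u v) : (Q.graph x y).Adj u v :=
  ⟨huv, .inl (.inr (.inr (.inl h)))⟩

lemma adj_of_block_eq (huv : u ≠ v) (h : Λ.block (Q.pos u) = Λ.block (Q.pos v)) :
    (Q.graph x y).Adj u v := by
  have hu := Λ.block_le (p := Q.pos u)
  have hu' := Λ.le_block_add_one (p := Q.pos u)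
  have hv := Λ.block_le (p := Q.pos v)
  have hv' := Λ.le_block_add_one (p := Q.pos v)
  obtain h | h | h : Q.pos u = Q.pos v ∨ Q.pos u + 1 = Q.pos v ∨ Q.pos v + 1 = Q.pos u := by omega
  · exact adj_of_pos_eq huv h
  · exact adj_of_pos_succ h
  · exact (adj_of_pos_succ h).symm

lemma eq_of_single (hu : (Λ.slot (Q.pos u)).kind = .single) (h : Q.pos u = Q.pos v) : u = v := by
  by_contra huv
  have ha : Q.pos u ≠ Λ.a := fun ha => by
    simp [ha, Λ.kind_a] at hu
  obtain ⟨τ, hτ, -⟩ := Q.exists_ne u v h ha huv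
  simp [Λ.mask_single _ hu] at hτ

lemma adj_single (h : (Q.graph x y).Adj u v) (hu : (Λ.slot (Q.pos u)).kind = .single) :
    Q.pos u + 1 = Q.pos v ∨ Q.pos v + 1 = Q.pos u := by
  have hleft : ∀ t < 2, Q.pos u ≠ Λ.a + 2 * t := fun t ht e => by simp [e, Λ.kind_left t ht] at hu
  have hright : ∀ t < 2, Q.pos u ≠ Λ.b + 2 * t := fun t ht e => by simp [e, Λ.kind_right t ht] at hu
  have hconf : ¬ Q.Conflict u v := fun ⟨τ, hτ, _⟩ => by
    simpa [Λ.mask_single _ hu] using hτ.mem_left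
  have ha := hleft 0 (by simp)
  have ha' := hleft 1 (by simp)
  have hb := hright 0 (by simp)
  have hb' := hright 1 (by simp)
  obtain ⟨huv, (h | h | h | h | h) | (h | h | h | h | h)⟩ := h
  any_goals omega
  · exact absurd (eq_of_single hu h) huv
  · exact absurd h hconf
  · exact absurd (eq_of_single hu h.symm) huv
  · exact absurd h.symm hconf

lemma conflict_of_adj (h : (Q.graph x y).Adj u v) (huv : Q.pos u + 1 < Q.pos v)
    (ha : Q.pos u ≠ Λ.a) (hb : ¬ (Q.pos u = Λ.b ∧ Q.pos v = Λ.b + 2)) : Q.Conflict u v := by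
  obtain ⟨-, (h | h | h | h | h) | (h | h | h | h | h)⟩ := h
  any_goals omega
  · exact h.symm

end Placement

end Layout

section ForcedPath

open Finset

namespace Layout.Placement

variable {k d m : ℕ} {Λ : Layout k d m} {V α : Type} {Q : Λ.Placement V α}
  {x y : Set ((Fin d → α) × (Fin d → α))} {f : ℕ → V}

lemma one_lt_card_block {p : ℕ} (hp : p < k) (h : (Λ.slot p).kind ≠ .single) :
    1 < #{i ∈ range k | Λ.block i = Λ.block p} := by
  obtain ⟨r, hr, hrp, hblock⟩ := exists_block_eq hp h
  exact one_lt_card.2 ⟨r, by simp [hr, hblock], p, by simp [hp], hrp⟩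

lemma card_fiber_block_le (hf : IsInducedPath (Q.graph x y) k f) (c : ℕ) :
    #{i ∈ range k | Λ.block (Q.pos (f i)) = c} ≤ #{i ∈ range k | Λ.block i = c} := by
  obtain hempty | ⟨i, hi⟩ := {i ∈ range k | Λ.block (Q.pos (f i)) = c}.eq_empty_or_nonempty
  · simp [hempty]
  obtain ⟨-, rfl⟩ := mem_filter.1 hi
  by_cases hsingle : (Λ.slot (Q.pos (f i))).kind = .single
  · have hpos : ∀ {j}, Λ.block (Q.pos (f j)) = Λ.block (Q.pos (f i)) → Q.pos (f j) = Q.pos (f i) :=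
      eq_of_block_eq_of_single hsingle
    refine (card_le_one.2 fun j hj l hl => ?_).trans
      (card_pos.2 ⟨Q.pos (f i), by simp [Q.pos_lt]⟩)
    obtain ⟨hj, hji⟩ := mem_filter.1 hj
    obtain ⟨hl, hli⟩ := mem_filter.1 hl
    exact hf.inj j (mem_range.1 hj) l (mem_range.1 hl) <|
      eq_of_single (by rwa [hpos hji]) ((hpos hji).trans (hpos hli).symm)
  · refine le_trans ?_ (one_lt_card_block (Q.pos_lt _) hsingle)
    by_contra! hcard
    obtain ⟨j, l, n, hj, hl, hn, hjl, hjn, hln⟩ := two_lt_card_iff.1 hcard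
    simp only [mem_filter, mem_range] at hj hl hn
    exact hf.triangle_free hj.1 hl.1 hn.1
      (adj_of_block_eq (hf.ne hj.1 hl.1 hjl) (hj.2.trans hl.2.symm))
      (adj_of_block_eq (hf.ne hj.1 hn.1 hjn) (hj.2.trans hn.2.symm))
      (adj_of_block_eq (hf.ne hl.1 hn.1 hln) (hl.2.trans hn.2.symm))

/-- An induced path meets a block in a clique, hence at most as often as the block has positions; as
it has `k` vertices, it does so exactly as often. -/
lemma card_fiber_block (hf : IsInducedPath (Q.graph x y) k f) (c : ℕ) :
    #{i ∈ range k | Λ.block (Q.pos (f i)) = c} = #{i ∈ range k | Λ.block i = c} :=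
  card_fiber_eq_of_forall_le (card_fiber_block_le hf) c

lemma exists_pos_eq_of_single (hf : IsInducedPath (Q.graph x y) k f) {p : ℕ} (hp : p < k)
    (h : (Λ.slot p).kind = .single) : ∃ i < k, Q.pos (f i) = p := by
  have hcard : 0 < #{i ∈ range k | Λ.block (Q.pos (f i)) = Λ.block p} := by
    rw [card_fiber_block hf]
    exact card_pos.2 ⟨p, by simp [hp]⟩
  obtain ⟨i, hi⟩ := card_pos.1 hcard
  obtain ⟨hi, hip⟩ := mem_filter.1 hi
  exact ⟨i, mem_range.1 hi, eq_of_block_eq_of_single h hip⟩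

lemma one_lt_card_fiber_block (hf : IsInducedPath (Q.graph x y) k f) {p : ℕ} (hp : p < k)
    (h : (Λ.slot p).kind ≠ .single) :
    1 < #{i ∈ range k | Λ.block (Q.pos (f i)) = Λ.block p} := by
  rw [card_fiber_block hf]
  exact one_lt_card_block hp h

lemma exists_mate (hf : IsInducedPath (Q.graph x y) k f) {i : ℕ}
    (h : (Λ.slot (Q.pos (f i))).kind ≠ .single) :
    ∃ j < k, j ≠ i ∧ Λ.block (Q.pos (f j)) = Λ.block (Q.pos (f i)) := by
  obtain ⟨j, hj, hji⟩ := exists_mem_ne (one_lt_card_fiber_block hf (Q.pos_lt _) h) i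
  obtain ⟨hj, hblock⟩ := mem_filter.1 hj
  exact ⟨j, mem_range.1 hj, hji, hblock⟩

section Step

variable {j : ℕ}

lemma lt_pos (hf : IsInducedPath (Q.graph x y) k f) (hpre : ∀ i ≤ j, Q.pos (f i) = i)
    (hj : (Λ.slot (j + 1)).kind ≠ .second) {i : ℕ} (hji : j < i) (hi : i < k) :
    j < Q.pos (f i) := by
  by_contra! hle
  set p := Q.pos (f i) with hp
  have hfp : f p ≠ f i := hf.ne (by omega) hi (by omega)
  have hkind : (Λ.slot p).kind ≠ .single := fun hkind =>
    hfp (eq_of_single (by rwa [hpre p hle]) (by rw [hpre p hle, ← hp]))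
  obtain ⟨r, hr, hrp, hblock⟩ := exists_block_eq (p := p) (Q.pos_lt _) hkind
  have hrj : r ≤ j := by
    have h := Λ.le_block_add_one (p := r)
    have h' := Λ.block_le (p := p)
    by_contra! hlt
    obtain rfl : r = j + 1 := by omega
    have := block_eq_self hj
    omega
  have hblock_pre : ∀ {l}, l ≤ j → Λ.block l = Λ.block p → Λ.block (Q.pos (f l)) = Λ.block p :=
    fun hl h => by rwa [hpre _ hl]
  exact hf.triangle_free (i := p) (j := r) (l := i) (by omega) hr hi
    (adj_of_block_eq (hf.ne (by omega) hr hrp.symm)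
      ((hblock_pre hle rfl).trans (hblock_pre hrj hblock).symm))
    (adj_of_block_eq hfp (hblock_pre hle rfl))
    (adj_of_block_eq (hf.ne hr hi (by omega)) (hblock_pre hrj hblock))

lemma pos_succ_of_single (hf : IsInducedPath (Q.graph x y) k f) (hpre : ∀ i ≤ j, Q.pos (f i) = i)
    (hj : j + 1 < k) (h : (Λ.slot (j + 1)).kind = .single) : Q.pos (f (j + 1)) = j + 1 := by
  obtain ⟨i, hi, hpos⟩ := exists_pos_eq_of_single hf hj h
  have hadj : (Q.graph x y).Adj (f j) (f i) := adj_of_pos_succ (by rw [hpre j le_rfl, hpos])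
  obtain rfl | hij := (hf.adj _ (by omega) _ hi).1 hadj
  · exact hpos
  · have := hpre i (by omega)
    omega

lemma pos_succ_of_second (hf : IsInducedPath (Q.graph x y) k f) (hpre : ∀ i ≤ j, Q.pos (f i) = i)
    (hj : j + 1 < k) (h : (Λ.slot (j + 1)).kind = .second) : Q.pos (f (j + 1)) = j + 1 := by
  have hfirst := (Λ.second_succ_iff j).1 h
  have hposj := hpre j le_rfl
  have hj0 : j ≠ 0 := by
    rintro rfl
    simp [Λ.kind_zero] at hfirst
  obtain ⟨i, hi, hij, hblock⟩ := exists_mate hf (i := j) (by simp [hposj, hfirst])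
  have hadj := (hf.adj _ (by omega) _ hi).1 (adj_of_block_eq (hf.ne (by omega) hi hij.symm)
    hblock.symm)
  rw [hposj, block_eq_self (p := j) (by simp [hfirst])] at hblock
  have hle := Λ.block_le (p := Q.pos (f i))
  have hle' := Λ.le_block_add_one (p := Q.pos (f i))
  obtain rfl | hadj := hadj
  · by_contra hne
    have hback : (Q.graph x y).Adj (f (j - 1)) (f (j + 1)) :=
      adj_of_pos_succ (by rw [hpre (j - 1) (by omega)]; omega)
    rw [hf.adj _ (by omega) _ hi] at hback
    omega
  · have := hpre i (by omega)
    omega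

section Skip

variable (hf : IsInducedPath (Q.graph x y) k f) (hpre : ∀ i ≤ j, Q.pos (f i) = i) (hj : j + 1 < k)
  (hfirst : (Λ.slot (j + 1)).kind = .first) (hskip : Q.pos (f (j + 1)) = j + 2)

include hf hpre hj hfirst hskip

lemma pos_add_two_of_skip : Q.pos (f (j + 2)) = j + 2 := by
  have hsecond := (Λ.second_succ_iff (j + 1)).2 hfirst
  obtain ⟨i, hi, hij, hblock⟩ := exists_mate hf (i := j + 1) (by simp [hskip, hsecond])
  have hadj := (hf.adj _ hj _ hi).1 (adj_of_block_eq (hf.ne hj hi hij.symm) hblock.symm)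
  rw [hskip, block_succ_of_first hfirst] at hblock
  have hle := Λ.block_le (p := Q.pos (f i))
  have hle' := Λ.le_block_add_one (p := Q.pos (f i))
  obtain (rfl : j + 2 = i) | hadj := hadj
  · by_contra hne
    have hback : (Q.graph x y).Adj (f j) (f (j + 2)) :=
      adj_of_pos_succ (by rw [hpre j le_rfl]; omega)
    rw [hf.adj _ (by omega) _ hi] at hback
    omega
  · have := hpre i (by omega)
    omega

lemma pos_ne_of_skip {i : ℕ} (hi : i < k) : Q.pos (f i) ≠ j + 3 := by
  intro hpos
  have hpos2 := pos_add_two_of_skip hf hpre hj hfirst hskip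
  have hj2 : j + 2 < k := Λ.succ_lt hj (by simp [hfirst])
  exact hf.triangle_free hj hj2 hi (adj_of_pos_eq (hf.ne hj hj2 (by omega)) (by omega))
    (adj_of_pos_succ (by omega)) (adj_of_pos_succ (by omega))

lemma exists_pair_of_skip : (Λ.slot (j + 3)).kind = .first ∧
    ∃ u < k, ∃ v < k, u ≠ v ∧ Q.pos (f u) = j + 4 ∧ Q.pos (f v) = j + 4 := by
  have hne : ∀ i < k, Q.pos (f i) ≠ j + 3 := fun i => pos_ne_of_skip hf hpre hj hfirst hskip
  have hj2 : (Λ.slot (j + 2)).kind = .second := (Λ.second_succ_iff (j + 1)).2 hfirst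
  have hj3 : j + 3 < k := Λ.succ_lt (Λ.succ_lt hj (by simp [hfirst])) (by simp [hj2])
  have hfirst3 : (Λ.slot (j + 3)).kind = .first := by
    rcases hkind : (Λ.slot (j + 3)).kind with _ | _ | _
    · obtain ⟨i, hi, hpos⟩ := exists_pos_eq_of_single hf hj3 hkind
      exact absurd hpos (hne i hi)
    · rfl
    · simp [(Λ.second_succ_iff (j + 2)).1 hkind] at hj2
  have hpos : ∀ i < k, Λ.block (Q.pos (f i)) = Λ.block (j + 3) → Q.pos (f i) = j + 4 := by
    intro i hi hblock
    rw [block_eq_self (p := j + 3) (by simp [hfirst3])] at hblock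
    have := Λ.block_le (p := Q.pos (f i))
    have := Λ.le_block_add_one (p := Q.pos (f i))
    have := hne i hi
    omega
  obtain ⟨u, hu, v, hv, huv⟩ := one_lt_card.1 (one_lt_card_fiber_block hf hj3 (by simp [hfirst3]))
  simp only [mem_filter, mem_range] at hu hv
  exact ⟨hfirst3, u, hu.1, v, hv.1, huv, hpos u hu.1 hu.2, hpos v hv.1 hv.2⟩

lemma adj_of_skip {τ : ℕ} (ha : j + 2 ≠ Λ.a) (hmask : (Λ.slot (j + 2)).mask.Subsingleton)
    (hτ : (Λ.slot (j + 2)).Compares (Λ.slot (j + 4)) τ) {u : ℕ} (hu : u < k)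
    (hpos : Q.pos (f u) = j + 4) : (Q.graph x y).Adj (f (j + 2)) (f u) := by
  have hpos2 := pos_add_two_of_skip hf hpre hj hfirst hskip
  have hj2 : j + 2 < k := Λ.succ_lt hj (by simp [hfirst])
  obtain ⟨τ', hτ', hne⟩ := Q.exists_ne (f (j + 1)) (f (j + 2)) (by omega) (by omega)
    (hf.ne hj hj2 (by omega))
  obtain rfl : ↑τ' = τ := hmask (by rwa [hskip] at hτ') hτ.mem_left
  have hword : Q.word (f (j + 1)) τ' = Q.word (f u) τ' := by
    by_contra hword
    have hadj : (Q.graph x y).Adj (f (j + 1)) (f u) :=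
      adj_of_conflict (fun e => by rw [← e] at hpos; omega) ⟨τ', by rwa [hskip, hpos], hword⟩
    obtain (rfl : j + 2 = u) | hadj := (hf.adj _ hj _ hu).1 hadj
    · omega
    · have := hpre u (by omega)
      omega
  exact adj_of_conflict (fun e => by rw [← e] at hpos; omega)
    ⟨τ', by rwa [hpos2, hpos], fun e => hne (hword.trans e.symm)⟩

end Skip

lemma not_skip (hf : IsInducedPath (Q.graph x y) k f) (hpre : ∀ i ≤ j, Q.pos (f i) = i)
    (hj : j + 1 < k) (hsecond : (Λ.slot j).kind = .second)
    (hfirst : (Λ.slot (j + 1)).kind = .first) : Q.pos (f (j + 1)) ≠ j + 2 := by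
  intro hskip
  have hposj := hpre j le_rfl
  obtain ⟨hfirst3, u, hu, v, hv, huv, hposu, hposv⟩ := exists_pair_of_skip hf hpre hj hfirst hskip
  have hadj : (Q.graph x y).Adj (f u) (f v) := adj_of_pos_eq (hf.ne hu hv huv) (by omega)
  have hja : j ≠ Λ.a := by
    rintro rfl
    simp [Λ.kind_a] at hsecond
  have hjb : j ≠ Λ.b := by
    rintro rfl
    simp [Λ.kind_right_hub] at hfirst3
  obtain ⟨τ, hτ, -⟩ := conflict_of_adj (hf.adj_succ hj) (by omega) (by omega) (by omega)
  rw [hposj, hskip] at hτ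
  obtain hsingle | ⟨ha, hmask, hτ'⟩ := Λ.stable j τ hsecond hfirst hτ hfirst3
  · have hj4 : (Λ.slot (j + 4)).kind = .second := (Λ.second_succ_iff (j + 3)).2 hfirst3
    have hj5 : j + 5 < k := Λ.succ_lt (hposu ▸ Q.pos_lt (f u)) (by simp [hj4])
    obtain ⟨i, hi, hpos⟩ := exists_pos_eq_of_single hf hj5 hsingle
    exact hf.triangle_free hu hv hi hadj (adj_of_pos_succ (by omega)) (adj_of_pos_succ (by omega))
  · have hadj' : ∀ i < k, Q.pos (f i) = j + 4 → (Q.graph x y).Adj (f (j + 2)) (f i) :=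
      fun i => adj_of_skip hf hpre hj hfirst hskip ha hmask hτ'
    exact hf.triangle_free (Λ.succ_lt hj (by simp [hfirst])) hu hv (hadj' u hu hposu)
      (hadj' v hv hposv) hadj

lemma not_conflict_of_guarded (hf : IsInducedPath (Q.graph x y) k f) (hj : j + 1 < k)
    (hposj : Q.pos (f j) = j) (hlt : j + 2 < Q.pos (f (j + 1)))
    (hsecond : (Λ.slot j).kind = .second) (hfirst : (Λ.slot (j + 1)).kind = .first) :
    ¬ Q.Conflict (f j) (f (j + 1)) := by
  rintro ⟨τ, hτ, -⟩
  rw [hposj] at hτ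
  set p := Q.pos (f (j + 1)) with hp
  have hpk : p < k := Q.pos_lt _
  have hkind : (Λ.slot p).kind ≠ .single := fun h => by
    simpa [Λ.mask_single _ h] using hτ.mem_right
  obtain ⟨i, hi, hij, hblock⟩ := exists_mate hf hkind
  rw [← hp] at hblock
  have hkindi : (Λ.slot (Q.pos (f i))).kind ≠ .single := fun h => by
    have := eq_of_block_eq_of_single h hblock.symm
    exact hkind (by rwa [this])
  obtain ⟨l, hl, hkindl, hpl⟩ : ∃ l < k, (Λ.slot (Q.pos (f l))).kind = .single ∧
      (Q.pos (f l) + 1 = p ∨ p + 1 = Q.pos (f l)) := by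
    obtain h | h := Λ.guarded j p τ hlt hsecond hfirst hτ
    · obtain ⟨l, hl, hpos⟩ := exists_pos_eq_of_single hf (by omega) h
      exact ⟨l, hl, by rwa [hpos], by omega⟩
    · obtain ⟨l, hl, hpos⟩ := exists_pos_eq_of_single hf (Λ.succ_lt hpk hkind) h
      exact ⟨l, hl, by rwa [hpos], by omega⟩
  have hadjl : (Q.graph x y).Adj (f (j + 1)) (f l) :=
    hpl.elim (fun h => (adj_of_pos_succ h).symm) adj_of_pos_succ
  have hblocki := Λ.le_block_add_one (p := p)
  have hblocki' := Λ.block_le (p := Q.pos (f i))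
  refine hf.claw_free (i := j) hj (by omega) hi hl ?_ ?_ ?_ (hf.adj_succ hj).symm
    (adj_of_block_eq (hf.ne hj hi hij.symm) hblock.symm) hadjl
  · rintro rfl
    omega
  · rintro rfl
    simp [hposj, hsecond] at hkindl
  · rintro rfl
    exact hkindi hkindl

lemma pos_succ_of_first (hf : IsInducedPath (Q.graph x y) k f) (hpre : ∀ i ≤ j, Q.pos (f i) = i)
    (hj : j + 1 < k) (hfirst : (Λ.slot (j + 1)).kind = .first) : Q.pos (f (j + 1)) = j + 1 := by
  have hposj := hpre j le_rfl
  have hlt : j < Q.pos (f (j + 1)) := lt_pos hf hpre (by simp [hfirst]) j.lt_succ_self hj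
  rcases hkind : (Λ.slot j).kind with _ | _ | _
  · have := adj_single (hf.adj_succ hj) (by rwa [hposj])
    omega
  · simp [(Λ.second_succ_iff j).2 hkind] at hfirst
  · by_contra hne
    have hskip := not_skip hf hpre hj hkind hfirst
    refine not_conflict_of_guarded hf hj hposj (by omega) hkind hfirst
      (conflict_of_adj (hf.adj_succ hj) (by omega) (fun ha => ?_) (by omega))
    rw [← hposj, ha, Λ.kind_a] at hkind
    cases hkind

end Step

lemma pos_eq_of_zero (hf : IsInducedPath (Q.graph x y) k f) (h : Q.pos (f 0) = 0) :
    ∀ j < k, Q.pos (f j) = j := by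
  intro j
  induction j using Nat.strong_induction_on with
  | _ j ih =>
    intro hj
    obtain _ | j := j
    · exact h
    have hpre : ∀ i ≤ j, Q.pos (f i) = i := fun i hi => ih i (by omega) (by omega)
    rcases hkind : (Λ.slot (j + 1)).kind with _ | _ | _
    · exact pos_succ_of_single hf hpre hj hkind
    · exact pos_succ_of_first hf hpre hj hkind
    · exact pos_succ_of_second hf hpre hj hkind

lemma exists_path_from_zero (hf : IsInducedPath (Q.graph x y) k f) :
    ∃ g, IsInducedPath (Q.graph x y) k g ∧ Q.pos (g 0) = 0 := by
  have hk := Λ.a_lt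
  obtain ⟨i, hi, hpos⟩ := exists_pos_eq_of_single hf (by omega) Λ.kind_zero
  have hpos_one : ∀ j, (Q.graph x y).Adj (f i) (f j) → Q.pos (f j) = 1 := fun j hadj => by
    have := adj_single hadj (by rw [hpos, Λ.kind_zero])
    omega
  obtain rfl | hi0 := Nat.eq_zero_or_pos i
  · exact ⟨f, hf, hpos⟩
  obtain hik | hik := Nat.lt_or_ge (i + 1) k
  · have hnext : (Q.graph x y).Adj (f i) (f (i + 1)) := hf.adj_succ hik
    have hprev : (Q.graph x y).Adj (f i) (f (i - 1)) :=
      (hf.adj _ hi _ (by omega)).2 (by omega)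
    exact absurd (adj_of_pos_eq (hf.ne hik (by omega) (by omega))
      ((hpos_one _ hnext).trans (hpos_one _ hprev).symm))
      (hf.triangle_free hi hik (by omega) hnext hprev)
  · refine ⟨_, hf.reverse, ?_⟩
    rwa [show k - 1 - 0 = i by omega]

lemma word_eq_of_compares (hf : IsInducedPath (Q.graph x y) k f) (hpos : ∀ j < k, Q.pos (f j) = j)
    {p r : ℕ} (hp : p < k) (hr : r < k) {τ : Fin d} (h : (Λ.slot p).Compares (Λ.slot r) τ) :
    Q.word (f p) τ = Q.word (f r) τ := by
  by_contra hne
  have hpr : p ≠ r := fun e => hne (by rw [e])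
  have hadj : (Q.graph x y).Adj (f p) (f r) :=
    adj_of_conflict (hf.ne hp hr hpr) ⟨τ, by rwa [hpos p hp, hpos r hr], hne⟩
  obtain rfl | rfl := (hf.adj _ hp _ hr).1 hadj
  · exact Λ.not_compares_succ _ _ h
  · exact Λ.not_compares_succ _ _ h.symm

lemma word_left_eq_word_right (hf : IsInducedPath (Q.graph x y) k f)
    (hpos : ∀ j < k, Q.pos (f j) = j) {t : ℕ} (ht : t < 2) :
    Q.word (f (Λ.a + 2 * t)) = Q.word (f (Λ.b + 2 * t)) := by
  have ha := Λ.a_lt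
  have hb := Λ.b_lt
  ext τ
  have hlayer : ∀ i ≤ m, ∀ p < k, (Λ.slot p).height = 2 * i + t → ↑τ ∈ (Λ.slot p).mask →
      Q.word (f (Λ.a + 2 * t)) τ = Q.word (f p) τ := by
    intro i
    induction i with
    | zero =>
      intro _ p hp hheight hmem
      have hleft := Λ.height_left t ht
      exact word_eq_of_compares hf hpos (by omega) hp
        ⟨by omega, by omega, by omega, Λ.mem_mask_left t ht τ τ.2, hmem⟩
    | succ i ih =>
      intro hi p hp hheight hmem
      obtain ⟨r, hr, hheight', hmem'⟩ := Λ.exists_slot (2 * i + t) (by omega) τ τ.2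
      rw [ih (by omega) r hr hheight' hmem']
      exact word_eq_of_compares hf hpos hr hp ⟨by omega, by omega, by omega, hmem', hmem⟩
  obtain ⟨r, hr, hheight, hmem⟩ := Λ.exists_slot (2 * m + t) (by omega) τ τ.2
  have hright := Λ.height_right t ht
  rw [hlayer m le_rfl r hr hheight hmem]
  exact word_eq_of_compares hf hpos hr (by omega)
    ⟨by omega, by omega, by omega, hmem, Λ.mem_mask_right t ht τ τ.2⟩

theorem not_disjoint_of_isInducedPath (hf : IsInducedPath (Q.graph x y) k f) :
    ¬ Disjoint x y := by
  obtain ⟨g, hg, hzero⟩ := exists_path_from_zero hf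
  have hpos := pos_eq_of_zero hg hzero
  have ha := Λ.a_lt
  have hb := Λ.b_lt
  have hallowed : ∀ p, p + 2 < k → ¬ Q.Forbidden x y (g p) (g (p + 2)) := by
    intro p hp h
    have hadj : (Q.graph x y).Adj (g p) (g (p + 2)) :=
      ⟨hg.ne (by omega) hp (by omega), .inl (.inr (.inr (.inr h)))⟩
    rw [hg.adj _ (by omega) _ hp] at hadj
    omega
  have hx : (Q.word (g Λ.a), Q.word (g (Λ.a + 2))) ∈ x := by
    by_contra hx
    exact hallowed Λ.a ha (.inl ⟨hpos _ (by omega), hpos _ ha, hx⟩)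
  have hy : (Q.word (g Λ.b), Q.word (g (Λ.b + 2))) ∈ y := by
    by_contra hy
    exact hallowed Λ.b (by omega) (.inr ⟨hpos _ (by omega), hpos _ (by omega), hy⟩)
  have hfst : Q.word (g Λ.a) = Q.word (g Λ.b) := word_left_eq_word_right hg hpos two_pos
  have hsnd : Q.word (g (Λ.a + 2)) = Q.word (g (Λ.b + 2)) :=
    word_left_eq_word_right hg hpos one_lt_two
  rw [hfst, hsnd] at hx
  exact Set.not_disjoint_iff.2 ⟨_, hx, hy⟩

end Layout.Placement

end ForcedPath

namespace Layout

section Instances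

variable {k d m : ℕ} {Λ : Layout k d m} {V α : Type}

namespace Placement

variable {Q : Λ.Placement V α} {x x' y y' : Set ((Fin d → α) × (Fin d → α))} {g : ℕ → V} {u v : V}

lemma isInducedPath_of_consistent (hpos : ∀ p < k, Q.pos (g p) = p)
    (hword : ∀ p < k, ∀ r < k, ¬ Q.Conflict (g p) (g r))
    (hx : (Q.word (g Λ.a), Q.word (g (Λ.a + 2))) ∈ x)
    (hy : (Q.word (g Λ.b), Q.word (g (Λ.b + 2))) ∈ y) : IsInducedPath (Q.graph x y) k g where
  inj p hp r hr h := by rw [← hpos p hp, ← hpos r hr, h]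
  adj p hp r hr := by
    have hallowed : ∀ p < k, ∀ r < k, ¬ Q.Forbidden x y (g p) (g r) := by
      rintro p hp r hr (⟨hp', hr', h⟩ | ⟨hp', hr', h⟩) <;>
        rw [hpos p hp] at hp' <;> rw [hpos r hr] at hr' <;> subst hp' hr' <;> exact h ‹_›
    have hne : p ≠ r → g p ≠ g r := fun hpr e => hpr (by rw [← hpos p hp, ← hpos r hr, e])
    simp only [graph, SimpleGraph.fromRel_adj, hpos p hp, hpos r hr, hword p hp r hr,
      hword r hr p hp, hallowed p hp r hr, hallowed r hr p hp, or_false]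
    constructor
    · rintro ⟨hpr, h⟩
      have : p ≠ r := fun e => hpr (by rw [e])
      omega
    · intro h
      exact ⟨hne (by omega), by omega⟩

lemma graph_connected (hpos : ∀ p < k, Q.pos (g p) = p) : (Q.graph x y).Connected := by
  have hpath : ∀ p < k, (Q.graph x y).Reachable (g 0) (g p) := by
    intro p
    induction p with
    | zero => exact fun _ => .rfl
    | succ p ih =>
      intro hp
      refine (ih (by omega)).trans (adj_of_pos_succ ?_).reachable
      rw [hpos p (by omega), hpos (p + 1) hp]
  have hreach : ∀ v, (Q.graph x y).Reachable (g 0) v := fun v => by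
    refine (hpath _ (Q.pos_lt v)).trans ?_
    by_cases h : g (Q.pos v) = v
    · rw [h]
    · exact (adj_of_pos_eq h (hpos _ (Q.pos_lt v))).reachable
  exact { preconnected := fun u v => (hreach u).symm.trans (hreach v), nonempty := ⟨g 0⟩ }

lemma graph_adj_iff_of_pos_ne_left (hu : Q.pos u ≠ Λ.a) (hv : Q.pos v ≠ Λ.a) :
    (Q.graph x y).Adj u v ↔ (Q.graph x' y).Adj u v := by
  simp only [graph, SimpleGraph.fromRel_adj, Forbidden, hu, hv, false_and, false_or]

lemma graph_adj_iff_of_pos_ne_right (hu : Q.pos u ≠ Λ.b + 2) (hv : Q.pos v ≠ Λ.b + 2) :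
    (Q.graph x y).Adj u v ↔ (Q.graph x y').Adj u v := by
  simp only [graph, SimpleGraph.fromRel_adj, Forbidden, hu, hv, false_and, and_false, or_false]

lemma card_le_of_subsingleton_mask [NeZero d] [Fintype α] {S : Set V} [Fintype S]
    (ha : ∀ v ∈ S, Q.pos v ≠ Λ.a)
    (hmask : ∀ v ∈ S, {τ : Fin d | ↑τ ∈ (Λ.slot (Q.pos v)).mask}.Subsingleton) :
    Fintype.card S ≤ k * Fintype.card α := by
  have hdigit : ∀ p, ∃ τ : Fin d, ∀ σ : Fin d, ↑σ ∈ (Λ.slot p).mask → ↑τ ∈ (Λ.slot p).mask := by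
    intro p
    by_cases h : ∃ τ : Fin d, ↑τ ∈ (Λ.slot p).mask
    · exact ⟨h.choose, fun _ _ => h.choose_spec⟩
    · exact ⟨0, fun σ hσ => absurd ⟨σ, hσ⟩ h⟩
  choose digit hdigit using hdigit
  have hinj : Function.Injective fun v : S =>
      ((⟨Q.pos v, Q.pos_lt v⟩ : Fin k), Q.word v (digit (Q.pos v))) := by
    rintro ⟨u, hu⟩ ⟨v, hv⟩ huv
    obtain ⟨hpos, hword⟩ := Prod.mk.injEq .. ▸ huv
    replace hpos : Q.pos u = Q.pos v := congrArg Fin.val hpos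
    by_contra hne
    obtain ⟨τ, hτ, hdiff⟩ := Q.exists_ne u v hpos (ha u hu) fun h => hne (Subtype.ext h)
    obtain rfl : τ = digit (Q.pos u) := hmask u hu hτ (hdigit _ _ hτ)
    exact hdiff (hword.trans (by rw [hpos]))
  simpa using Fintype.card_le_of_injective _ hinj

end Placement

variable [Zero α]

variable (Λ α) in
/-- The vertices of the construction, one for each position and each value of the digits stored
there; the digits that are not stored are set to `0`. -/
def Core : Type :=
  {v : Fin k × (Fin d → α) // ∀ τ : Fin d, ↑τ ∉ (Λ.slot v.1).mask → v.2 τ = 0}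

noncomputable instance [Fintype α] : Fintype (Λ.Core α) :=
  haveI := Classical.decEq α
  haveI := Classical.decPred fun v : Fin k × (Fin d → α) =>
    ∀ τ : Fin d, ↑τ ∉ (Λ.slot v.1).mask → v.2 τ = 0
  Subtype.fintype _

lemma card_core_le [Fintype α] : Fintype.card (Λ.Core α) ≤ k * Fintype.card α ^ d := by
  calc Fintype.card (Λ.Core α) ≤ Fintype.card (Fin k × (Fin d → α)) :=
        Fintype.card_le_of_injective (fun v : Λ.Core α => v.1) Subtype.val_injective
    _ = k * Fintype.card α ^ d := by
        rw [Fintype.card_prod, Fintype.card_fun, Fintype.card_fin, Fintype.card_fin]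

variable (Λ α) in
/-- The vertices of the construction, together with `r` spare copies of a vertex at the position
`Λ.a`, which adjust the number of vertices. -/
def placement (r : ℕ) : Λ.Placement (Λ.Core α ⊕ Fin r) α where
  pos := Sum.elim (fun v => v.1.1) fun _ => Λ.a
  word := Sum.elim (fun v => v.1.2) 0
  pos_lt := by
    have := Λ.a_lt
    rintro (v | -)
    · exact v.1.1.2
    · exact (show Λ.a < k by omega)
  exists_ne := by
    rintro (u | u) (v | v) hpos ha hne
    · have hword : u.1.2 ≠ v.1.2 := fun h =>
        hne (congrArg _ (Subtype.ext (Prod.ext (Fin.ext hpos) h)))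
      obtain ⟨τ, hτ⟩ := Function.ne_iff.1 hword
      refine ⟨τ, ?_, hτ⟩
      by_contra hmask
      have hmask' : ↑τ ∉ (Λ.slot v.1.1).mask := by
        rwa [show (v.1.1 : ℕ) = u.1.1 from hpos.symm]
      exact hτ ((u.2 τ hmask).trans (v.2 τ hmask').symm)
    · exact absurd hpos ha
    · exact absurd rfl ha
    · exact absurd rfl ha

variable (Λ) in
open Classical in
/-- The vertex that stores the pair of words `w` at the position `p % k`. -/
noncomputable def spell (r : ℕ) (w : (Fin d → α) × (Fin d → α)) (p : ℕ) : Λ.Core α ⊕ Fin r :=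
  .inl ⟨(⟨p % k, Nat.mod_lt _ (by have := Λ.a_lt; omega)⟩, fun τ =>
    if ↑τ ∈ (Λ.slot (p % k)).mask then
      if (Λ.slot (p % k)).height % 2 = 0 then w.1 τ else w.2 τ
    else 0), fun _ hτ => if_neg hτ⟩

variable {r p : ℕ} {w : (Fin d → α) × (Fin d → α)}

lemma pos_spell (hp : p < k) : (Λ.placement α r).pos (Λ.spell r w p) = p :=
  Nat.mod_eq_of_lt hp

lemma word_spell (hp : p < k) {τ : Fin d} (hτ : ↑τ ∈ (Λ.slot p).mask) :
    (Λ.placement α r).word (Λ.spell r w p) τ =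
      if (Λ.slot p).height % 2 = 0 then w.1 τ else w.2 τ := by
  classical
  have hmod : p % k = p := Nat.mod_eq_of_lt hp
  change (if ↑τ ∈ (Λ.slot (p % k)).mask then
    if (Λ.slot (p % k)).height % 2 = 0 then w.1 τ else w.2 τ else 0) = _
  rw [hmod, if_pos hτ]

lemma word_spell_left {t : ℕ} (ht : t < 2) : (Λ.placement α r).word (Λ.spell r w (Λ.a + 2 * t)) =
    if t = 0 then w.1 else w.2 := by
  have := Λ.a_lt
  ext τ
  rw [word_spell (by omega) (Λ.mem_mask_left t ht τ τ.2), Λ.height_left t ht, Nat.mod_eq_of_lt ht]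
  split_ifs <;> rfl

lemma word_spell_right {t : ℕ} (ht : t < 2) : (Λ.placement α r).word (Λ.spell r w (Λ.b + 2 * t)) =
    if t = 0 then w.1 else w.2 := by
  have := Λ.b_lt
  ext τ
  rw [word_spell (by omega) (Λ.mem_mask_right t ht τ τ.2), Λ.height_right t ht,
    show (2 * m + 2 + t) % 2 = t by omega]
  split_ifs <;> rfl

lemma isInducedPath_spell {x y : Set ((Fin d → α) × (Fin d → α))} (hx : w ∈ x) (hy : w ∈ y) :
    IsInducedPath ((Λ.placement α r).graph x y) k (Λ.spell r w) := by
  refine Placement.isInducedPath_of_consistent (fun p => pos_spell) (fun p hp q hq => ?_) ?_ ?_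
  · rintro ⟨τ, hτ, hne⟩
    rw [pos_spell hp, pos_spell hq] at hτ
    rw [word_spell hp hτ.mem_left, word_spell hq hτ.mem_right, hτ.parity] at hne
    exact hne rfl
  · exact Set.mem_of_eq_of_mem (Prod.ext (word_spell_left (r := r) (t := 0) two_pos)
      (word_spell_left (r := r) (t := 1) one_lt_two)) hx
  · exact Set.mem_of_eq_of_mem (Prod.ext (word_spell_right (r := r) (t := 0) two_pos)
      (word_spell_right (r := r) (t := 1) one_lt_two)) hy

lemma pathFree_graph_iff {x y : Set ((Fin d → α) × (Fin d → α))} :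
    PathFree k ((Λ.placement α r).graph x y) ↔ Disjoint x y := by
  have : Nonempty (Λ.Core α ⊕ Fin r) := ⟨Λ.spell r 0 0⟩
  rw [← not_iff_not, not_pathFree_iff]
  constructor
  · rintro ⟨f, hf⟩
    exact Placement.not_disjoint_of_isInducedPath hf
  · intro h
    obtain ⟨w, hx, hy⟩ := Set.not_disjoint_iff.1 h
    exact ⟨_, isInducedPath_spell hx hy⟩

end Instances

/-- Read off the height of a slot, `φ` measures twice the distance of a vertex to layer `0`, in the
sense required by `DisjointnessGadget`. -/
structure IsPotential {k d m : ℕ} (Λ : Layout k d m) (φ : ℕ → ℕ) : Prop where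
  zero : φ 0 = 0
  one_le : φ 1 ≤ 2
  add_two : ∀ z, φ (z + 2) = φ z + 2
  le_succ : ∀ p, p + 1 < k → φ (Λ.slot p).height ≤ φ (Λ.slot (p + 1)).height + 2
  succ_le : ∀ p, p + 1 < k → φ (Λ.slot (p + 1)).height ≤ φ (Λ.slot p).height + 2

namespace IsPotential

variable {k d m : ℕ} {Λ : Layout k d m} {φ : ℕ → ℕ} {V α : Type}

lemma le_of_compares (hφ : Λ.IsPotential φ) {S T : Slot} {τ : ℕ} (h : S.Compares T τ) :
    φ S.height ≤ φ T.height + 2 := by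
  obtain h | h | h : S.height = T.height ∨ S.height = T.height + 2 ∨ T.height = S.height + 2 := by
    have := h.parity
    have := h.le
    have := h.ge
    omega
  all_goals rw [h]
  · omega
  · rw [hφ.add_two]
  · rw [hφ.add_two]
    omega

lemma apply_even (hφ : Λ.IsPotential φ) (i : ℕ) : φ (2 * i) = 2 * i := by
  induction i with
  | zero => exact hφ.zero
  | succ i ih => rw [mul_add, mul_one, hφ.add_two, ih]

lemma apply_odd (hφ : Λ.IsPotential φ) (i : ℕ) : φ (2 * i + 1) = 2 * i + φ 1 := by
  induction i with
  | zero => simp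
  | succ i ih =>
    rw [show 2 * (i + 1) + 1 = 2 * i + 1 + 2 by ring, hφ.add_two, ih]
    ring

lemma level_left (hφ : Λ.IsPotential φ) : φ (Λ.slot Λ.a).height = 0 := by
  rw [show (Λ.slot Λ.a).height = 0 from Λ.height_left 0 two_pos, hφ.zero]

lemma level_right (Λ : Layout k d m) (φ : ℕ → ℕ) :
    φ (Λ.slot (Λ.b + 2)).height = φ (2 * m + 3) :=
  congrArg φ (Λ.height_right 1 one_lt_two)

lemma le_of_forbidden (hφ : Λ.IsPotential φ) {Q : Λ.Placement V α}
    {x y : Set ((Fin d → α) × (Fin d → α))} {u v : V} (h : Q.Forbidden x y u v) :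
    φ (Λ.slot (Q.pos u)).height ≤ φ (Λ.slot (Q.pos v)).height + 2 ∧
      φ (Λ.slot (Q.pos v)).height ≤ φ (Λ.slot (Q.pos u)).height + 2 := by
  have hone := hφ.one_le
  obtain ⟨hu, hv, -⟩ | ⟨hu, hv, -⟩ := h
  · rw [hu, hv, hφ.level_left,
      show (Λ.slot (Λ.a + 2)).height = 1 from Λ.height_left 1 one_lt_two]
    omega
  · rw [hu, hv, level_right Λ φ,
      show (Λ.slot Λ.b).height = 2 * (m + 1) from Λ.height_right 0 two_pos, hφ.apply_even,
      show 2 * m + 3 = 2 * (m + 1) + 1 by ring, hφ.apply_odd]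
    omega

lemma le_of_adj (hφ : Λ.IsPotential φ) {Q : Λ.Placement V α}
    {x y : Set ((Fin d → α) × (Fin d → α))} {u v : V} (h : (Q.graph x y).Adj u v) :
    φ (Λ.slot (Q.pos v)).height ≤ φ (Λ.slot (Q.pos u)).height + 2 := by
  have hu := Q.pos_lt u
  have hv := Q.pos_lt v
  obtain ⟨-, (h | h | ⟨τ, hτ, -⟩ | h) | (h | h | ⟨τ, hτ, -⟩ | h)⟩ := h
  · rw [h]
    omega
  · rw [← h]
    exact hφ.succ_le _ (by omega)
  · exact hφ.le_of_compares hτ.symm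
  · exact (hφ.le_of_forbidden h).2
  · rw [h]
    omega
  · rw [← h]
    exact hφ.le_succ _ (by omega)
  · exact hφ.le_of_compares hτ
  · exact (hφ.le_of_forbidden h).1

/-- Path-freeness of the graphs of a layout tests disjointness of sets of pairs of words. -/
def gadget [Zero α] (hφ : Λ.IsPotential φ) (r : ℕ) :
    DisjointnessGadget (fun _ G => PathFree k G) (Λ.Core α ⊕ Fin r)
      ((Fin d → α) × (Fin d → α)) where
  graph := (Λ.placement α r).graph
  level v := φ (Λ.slot ((Λ.placement α r).pos v)).height
  top := φ (2 * m + 3)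
  connected _ _ := Placement.graph_connected (g := Λ.spell r 0) fun _ => pos_spell
  level_le := hφ.le_of_adj
  adj_iff_of_pos hu hv _ _ _ := Placement.graph_adj_iff_of_pos_ne_left
    (fun h => by simp [h, hφ.level_left] at hu) (fun h => by simp [h, hφ.level_left] at hv)
  adj_iff_of_lt_top hu hv _ _ _ := Placement.graph_adj_iff_of_pos_ne_right
    (fun h => by simp [h, level_right] at hu) (fun h => by simp [h, level_right] at hv)
  property_iff _ _ := pathFree_graph_iff

lemma card_words_sq_le [NeZero d] [Zero α] [Fintype α] (hφ : Λ.IsPotential φ)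
    (hmask : ∀ p, 0 < φ (Λ.slot p).height → φ (Λ.slot p).height < φ (2 * m + 3) →
      {τ : Fin d | ↑τ ∈ (Λ.slot p).mask}.Subsingleton)
    {ℓ n M s : ℕ} (hℓ : 4 * ℓ < φ (2 * m + 3)) (hn : k * Fintype.card α ^ d ≤ n) (hM : n ≤ M)
    (h : HasPLS (fun _ G => PathFree k G) ℓ n M s) :
    (Fintype.card α ^ d) ^ 2 ≤ s * (k * Fintype.card α) := by
  classical
  set r := n - Fintype.card (Λ.Core α)
  have hcard : Fintype.card (Λ.Core α ⊕ Fin r) = n := by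
    rw [Fintype.card_sum, Fintype.card_fin, Nat.add_sub_cancel' (card_core_le.trans hn)]
  have hle := (hφ.gadget (α := α) r).card_le_of_hasPLS hℓ (hcard.trans_le hM) (by rwa [hcard])
  have hsep : Fintype.card (hφ.gadget (α := α) r).separator ≤ k * Fintype.card α :=
    Placement.card_le_of_subsingleton_mask (Q := Λ.placement α r)
      (fun v hv ha => hv.1.ne' ((congrArg (fun p => φ (Λ.slot p).height) ha).trans hφ.level_left))
      fun v hv => hmask _ hv.1 hv.2
  calc (Fintype.card α ^ d) ^ 2 = Fintype.card ((Fin d → α) × (Fin d → α)) := by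
        rw [Fintype.card_prod, Fintype.card_fun, Fintype.card_fin, sq]
    _ ≤ s * Fintype.card (hφ.gadget (α := α) r).separator := hle
    _ ≤ s * (k * Fintype.card α) := by gcongr

end IsPotential

end Layout

section PathLayout

variable {m E : ℕ}

/-- The slot of a vertex that stores nothing, before the words. -/
def pendantSlot : Slot := ⟨.single, 0, ∅⟩

/-- The `y`-th slot of the bridge, for `y ≤ 2 * m + 5`: it leads from the two words in full on layer
`0`, at `0` and `2`, to the two words in full on layer `m + 1`, at `2 * m + 3` and `2 * m + 5`, and
carries the digit `0` in between. -/
def bridgeSlot (m y : ℕ) : Slot where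
  kind := if y % 2 = 0 then .first else .second
  height := min (y - 1) (2 * m + 3)
  mask := {τ | y ≠ 1 ∧ y ≠ 2 * m + 4 ∧
    (τ = 0 ∨ y = 0 ∨ y = 2 ∨ y = 2 * m + 3 ∨ y = 2 * m + 5)}

/-- The `s`-th slot of the run that carries the digit `t + 1`, for `s ≤ 2 * m`; the one at `0` is
the hub that separates the run from what precedes it. The runs go back and forth between the two
sides. -/
def runSlot (m t s : ℕ) : Slot where
  kind := if s = 0 then .single else if s % 2 = 1 then .first else .second
  height := if t % 2 = 1 then s + 2 * (s % 2) else 2 * m + 3 - (s + 2 * (s % 2))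
  mask := {τ | s ≠ 0 ∧ τ = t + 1}

lemma kind_bridgeSlot_eq_first {y : ℕ} : (bridgeSlot m y).kind = .first ↔ y % 2 = 0 := by
  simp only [bridgeSlot]
  split_ifs <;> simp [*]

lemma kind_bridgeSlot_eq_second {y : ℕ} : (bridgeSlot m y).kind = .second ↔ y % 2 = 1 := by
  simp only [bridgeSlot]
  split_ifs <;> simp_all

lemma kind_bridgeSlot_ne_single {y : ℕ} : (bridgeSlot m y).kind ≠ .single := by
  simp only [bridgeSlot]
  split_ifs <;> simp

lemma kind_runSlot_eq_single {t s : ℕ} : (runSlot m t s).kind = .single ↔ s = 0 := by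
  simp only [runSlot]
  split_ifs <;> simp [*]

lemma kind_runSlot_eq_first {t s : ℕ} : (runSlot m t s).kind = .first ↔ s % 2 = 1 := by
  simp only [runSlot]
  split_ifs <;> simp [*]

lemma kind_runSlot_eq_second {t s : ℕ} :
    (runSlot m t s).kind = .second ↔ s ≠ 0 ∧ s % 2 = 0 := by
  simp only [runSlot]
  split_ifs <;> simp_all

/-- The position at which the run of the digit `t + 1` begins. -/
def runStart (m E t : ℕ) : ℕ := E + 6 + 2 * m + t * (2 * m + 1)

lemma runStart_succ (t : ℕ) : runStart m E (t + 1) = runStart m E t + 2 * m + 1 := by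
  rw [runStart, runStart]
  ring

lemma runStart_zero : runStart m E 0 = E + 6 + 2 * m := by
  rw [runStart, zero_mul, add_zero]

lemma le_runStart (m E t : ℕ) : E + 6 + 2 * m ≤ runStart m E t := Nat.le_add_right _ _

lemma runStart_mono : Monotone (runStart m E) := fun _ _ h => by
  rw [runStart, runStart]
  gcongr

/-- The sequence of slots of the construction: `E` pendant slots, the bridge, and the runs. -/
def pathSlot (m E p : ℕ) : Slot :=
  if p < E then pendantSlot
  else if p < E + 6 + 2 * m then bridgeSlot m (p - E)
  else runSlot m ((p - (E + 6 + 2 * m)) / (2 * m + 1)) ((p - (E + 6 + 2 * m)) % (2 * m + 1))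

lemma pathSlot_pendant {p : ℕ} (hp : p < E) : pathSlot m E p = pendantSlot := if_pos hp

lemma pathSlot_bridge {p y : ℕ} (hy : y ≤ 2 * m + 5) (hp : p = E + y) :
    pathSlot m E p = bridgeSlot m y := by
  rw [pathSlot, if_neg (by omega), if_pos (by omega), hp, Nat.add_sub_cancel_left]

lemma pathSlot_run {p t s : ℕ} (hs : s ≤ 2 * m) (hp : p = runStart m E t + s) :
    pathSlot m E p = runSlot m t s := by
  have hstart := le_runStart m E t
  have hsub : p - (E + 6 + 2 * m) = s + (2 * m + 1) * t := by
    rw [hp, runStart, mul_comm t]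
    omega
  rw [pathSlot, if_neg (by omega), if_neg (by omega), hsub, Nat.add_mul_div_left _ _ (by omega),
    Nat.add_mul_mod_self_left, Nat.div_eq_of_lt (by omega), Nat.mod_eq_of_lt (by omega),
    Nat.zero_add]

lemma kind_pathSlot_of_eq_runStart {p t : ℕ} (hp : p = runStart m E t) :
    (pathSlot m E p).kind = .single := by
  rw [pathSlot_run (Nat.zero_le _) hp, kind_runSlot_eq_single]

lemma pendant_or_bridge_or_run (m E p : ℕ) :
    p < E ∨ (∃ y ≤ 2 * m + 5, p = E + y) ∨ ∃ t, ∃ s ≤ 2 * m, p = runStart m E t + s := by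
  rcases Nat.lt_or_ge p E with hE | hE
  · exact .inl hE
  rcases Nat.lt_or_ge p (E + 6 + 2 * m) with hp | hp
  · exact .inr (.inl ⟨p - E, by omega, by omega⟩)
  refine .inr (.inr ⟨(p - (E + 6 + 2 * m)) / (2 * m + 1), (p - (E + 6 + 2 * m)) % (2 * m + 1),
    Nat.lt_succ_iff.1 (Nat.mod_lt _ (by omega)), ?_⟩)
  have := Nat.div_add_mod' (p - (E + 6 + 2 * m)) (2 * m + 1)
  rw [runStart]
  omega

lemma pathSlot_succ_induction {C : Slot → Slot → Prop} (hpendant : C pendantSlot pendantSlot)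
    (henter : C pendantSlot (bridgeSlot m 0))
    (hbridge : ∀ y < 2 * m + 5, C (bridgeSlot m y) (bridgeSlot m (y + 1)))
    (hleave : C (bridgeSlot m (2 * m + 5)) (runSlot m 0 0))
    (hrun : ∀ t, ∀ s < 2 * m, C (runSlot m t s) (runSlot m t (s + 1)))
    (hturn : ∀ t, C (runSlot m t (2 * m)) (runSlot m (t + 1) 0)) (p : ℕ) :
    C (pathSlot m E p) (pathSlot m E (p + 1)) := by
  obtain hp | ⟨y, hy, rfl⟩ | ⟨t, s, hs, rfl⟩ := pendant_or_bridge_or_run m E p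
  · rw [pathSlot_pendant hp]
    obtain hp' | hp' : p + 1 < E ∨ p + 1 = E + 0 := by omega
    · rwa [pathSlot_pendant hp']
    · rwa [pathSlot_bridge (Nat.zero_le _) hp']
  · rw [pathSlot_bridge hy rfl]
    obtain hy' | rfl : y < 2 * m + 5 ∨ y = 2 * m + 5 := by omega
    · rw [pathSlot_bridge hy' (add_assoc ..)]
      exact hbridge y hy'
    · rwa [pathSlot_run (t := 0) (Nat.zero_le _) (by rw [runStart_zero]; omega)]
  · rw [pathSlot_run hs rfl]
    obtain hs' | rfl : s < 2 * m ∨ s = 2 * m := by omega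
    · rw [pathSlot_run hs' (add_assoc ..)]
      exact hrun t s hs'
    · rw [pathSlot_run (Nat.zero_le _) (by rw [runStart_succ, add_zero])]
      exact hturn t

lemma kind_pathSlot_succ_eq_second_iff (p : ℕ) :
    (pathSlot m E (p + 1)).kind = .second ↔ (pathSlot m E p).kind = .first := by
  refine pathSlot_succ_induction (C := fun S T => T.kind = .second ↔ S.kind = .first)
    (by simp [pendantSlot]) ?_ ?_ ?_ ?_ ?_ p
  · simp [pendantSlot, bridgeSlot]
  · intro y _
    rw [kind_bridgeSlot_eq_first, kind_bridgeSlot_eq_second]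
    omega
  · rw [kind_bridgeSlot_eq_first, kind_runSlot_eq_second]
    omega
  · intro t s _
    rw [kind_runSlot_eq_first, kind_runSlot_eq_second]
    omega
  · intro t
    rw [kind_runSlot_eq_first, kind_runSlot_eq_second]
    omega

lemma not_compares_pathSlot_succ (p τ : ℕ) :
    ¬ (pathSlot m E p).Compares (pathSlot m E (p + 1)) τ := by
  refine pathSlot_succ_induction (C := fun S T => ¬ S.Compares T τ) (fun h => h.mem_left)
    (fun h => h.mem_left) ?_ (fun h => h.mem_right.1 rfl) ?_ (fun t h => h.mem_right.1 rfl) p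
  · rintro y hy ⟨hpar, -, -, ⟨-, hy₁, -⟩, hy₂, -⟩
    simp only [bridgeSlot] at hpar
    omega
  · rintro t s hs ⟨hpar, -⟩
    simp only [runSlot] at hpar
    split_ifs at hpar <;> omega

lemma mask_pathSlot_of_single (p : ℕ) (h : (pathSlot m E p).kind = .single) :
    (pathSlot m E p).mask = ∅ := by
  obtain hp | ⟨y, hy, rfl⟩ | ⟨t, s, hs, rfl⟩ := pendant_or_bridge_or_run m E p
  · rw [pathSlot_pendant hp]
    rfl
  · rw [pathSlot_bridge hy rfl] at h
    exact absurd h kind_bridgeSlot_ne_single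
  · rw [pathSlot_run hs rfl] at h ⊢
    ext τ
    simp only [runSlot, kind_runSlot_eq_single.1 h, ne_eq, not_true, false_and, Set.mem_ofPred_eq,
      Set.mem_empty_iff_false]

lemma exists_pathSlot {D z τ : ℕ} (hz : z < 2 * m + 2) (hτ : τ < D + 1) :
    ∃ p ≤ runStart m E D, (pathSlot m E p).height = z ∧ τ ∈ (pathSlot m E p).mask := by
  have hstart := le_runStart m E D
  have hbridge : ∀ y ≤ 2 * m + 5, min (y - 1) (2 * m + 3) = z → τ ∈ (bridgeSlot m y).mask →
      ∃ p ≤ runStart m E D, (pathSlot m E p).height = z ∧ τ ∈ (pathSlot m E p).mask :=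
    fun y hy hz hτ => ⟨E + y, by omega, by rw [pathSlot_bridge hy rfl]; exact ⟨hz, hτ⟩⟩
  obtain rfl | hz₀ := eq_or_ne z 0
  · exact hbridge 0 (by omega) (by omega) ⟨by omega, by omega, by omega⟩
  obtain h | h : (τ = 0 ∨ z = 1) ∨ τ ≠ 0 ∧ z ≠ 1 := by omega
  · exact hbridge (z + 1) (by omega) (by omega) ⟨by omega, by omega, by omega⟩
  obtain ⟨t, rfl⟩ := Nat.exists_eq_succ_of_ne_zero h.1
  have hrun : ∀ s, s ≤ 2 * m → s ≠ 0 → (runSlot m t s).height = z →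
      ∃ p ≤ runStart m E D, (pathSlot m E p).height = z ∧ t + 1 ∈ (pathSlot m E p).mask := by
    intro s hs hs₀ hz
    have := runStart_mono (m := m) (E := E) (show t + 1 ≤ D by omega)
    rw [runStart_succ] at this
    exact ⟨runStart m E t + s, by omega, by rw [pathSlot_run hs rfl]; exact ⟨hz, hs₀, rfl⟩⟩
  by_cases ht : t % 2 = 1
  · refine hrun (z - 2 * (z % 2)) (by omega) (by omega) ?_
    simp only [runSlot, ht, if_true]
    omega
  · refine hrun (2 * m + 3 - z - 2 * ((z + 1) % 2)) (by omega) (by omega) ?_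
    simp only [runSlot, ht, if_false]
    omega

lemma le_of_kind_pathSlot_bridge {y : ℕ} (hy : y ≤ 2 * m + 5) (hy₀ : y % 2 = 1)
    (hy₁ : (pathSlot m E (E + y + 1)).kind = .first) : y ≤ 2 * m + 3 := by
  by_contra hlt
  rw [kind_pathSlot_of_eq_runStart (t := 0) (by rw [runStart_zero]; omega)] at hy₁
  cases hy₁

lemma single_of_compares_bridge {y p τ : ℕ} (hy : y ≤ 2 * m + 3) (hy₀ : y % 2 = 1)
    (hp : E + y + 2 < p) (h : (bridgeSlot m y).Compares (pathSlot m E p) τ) :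
    (pathSlot m E (p - 1)).kind = .single ∨ (pathSlot m E (p + 1)).kind = .single := by
  obtain ⟨hpar, hle, hge, hτ, hτ'⟩ := h
  obtain hp' | ⟨y', hy', rfl⟩ | ⟨t, s, hs, rfl⟩ := pendant_or_bridge_or_run m E p
  · omega
  · rw [pathSlot_bridge hy' rfl] at hpar hge
    simp only [bridgeSlot, Set.mem_ofPred_eq] at hpar hge hτ
    omega
  rw [pathSlot_run hs rfl] at hpar hle hge hτ'
  simp only [bridgeSlot, runSlot, Set.mem_ofPred_eq] at hpar hle hge hτ hτ'
  obtain rfl : y = 2 * m + 3 := by omega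
  obtain rfl | rfl : s = 1 ∨ s = 2 * m := by
    split_ifs at hpar hle <;> omega
  · exact .inl (kind_pathSlot_of_eq_runStart rfl)
  · exact .inr (kind_pathSlot_of_eq_runStart (runStart_succ t).symm)

lemma not_compares_runSlot {t s s' : ℕ} (hs : s % 2 = 0) (hss' : s + 2 < s') (hs' : s' ≤ 2 * m)
    (τ : ℕ) : ¬ (runSlot m t s).Compares (runSlot m t s') τ := by
  rintro ⟨hpar, hle, hge, -⟩
  simp only [runSlot] at hpar hle hge
  split_ifs at hpar hle hge <;> omega

lemma single_of_compares_pathSlot (j p τ : ℕ) (hjp : j + 2 < p)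
    (hj : (pathSlot m E j).kind = .second) (hj₁ : (pathSlot m E (j + 1)).kind = .first)
    (h : (pathSlot m E j).Compares (pathSlot m E p) τ) :
    (pathSlot m E (p - 1)).kind = .single ∨ (pathSlot m E (p + 1)).kind = .single := by
  obtain hj' | ⟨y, hy, rfl⟩ | ⟨t, s, hs, rfl⟩ := pendant_or_bridge_or_run m E j
  · rw [pathSlot_pendant hj'] at hj
    cases hj
  · rw [pathSlot_bridge hy rfl] at hj h
    have hy₀ := kind_bridgeSlot_eq_second.1 hj
    exact single_of_compares_bridge (le_of_kind_pathSlot_bridge hy hy₀ hj₁) hy₀ hjp h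
  rw [pathSlot_run hs rfl] at hj h
  have hstart := le_runStart m E t
  obtain hp | ⟨y, hy, rfl⟩ | ⟨t', s', hs', rfl⟩ := pendant_or_bridge_or_run m E p
  · omega
  · omega
  rw [pathSlot_run hs' rfl] at h
  obtain rfl : t = t' := Nat.succ_injective (h.mem_left.2.symm.trans h.mem_right.2)
  exact absurd h (not_compares_runSlot (kind_runSlot_eq_second.1 hj).2 (by omega) hs' τ)

lemma stable_bridge {y τ : ℕ} (hy : y ≤ 2 * m + 3) (hy₀ : y % 2 = 1)
    (hy₃ : (pathSlot m E (E + y + 3)).kind = .first) (hτ : τ ∈ (bridgeSlot m y).mask)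
    (hτ' : τ ∈ (pathSlot m E (E + y + 2)).mask) :
    (pathSlot m E (E + y + 5)).kind = .single ∨
      (pathSlot m E (E + y + 2)).mask.Subsingleton ∧
        (pathSlot m E (E + y + 2)).Compares (pathSlot m E (E + y + 4)) τ := by
  obtain hy' | rfl | rfl : y + 4 ≤ 2 * m + 3 ∨ y = 2 * m + 1 ∨ y = 2 * m + 3 := by omega
  · right
    rw [pathSlot_bridge (y := y + 2) (by omega) (add_assoc ..)] at hτ' ⊢
    rw [pathSlot_bridge (y := y + 4) (by omega) (add_assoc ..)]
    simp only [bridgeSlot, Set.mem_ofPred_eq] at hτ hτ'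
    refine ⟨fun σ hσ σ' hσ' => ?_, ⟨?_, ?_, ?_, hτ', ?_⟩⟩ <;>
      simp only [bridgeSlot, Set.mem_ofPred_eq] at * <;> omega
  · exact .inl (kind_pathSlot_of_eq_runStart (t := 0) (by rw [runStart_zero]; omega))
  · rw [kind_pathSlot_of_eq_runStart (t := 0) (by rw [runStart_zero]; omega)] at hy₃
    cases hy₃

lemma runSlot_compares_add_two {t s : ℕ} (hs₀ : s ≠ 0) (hs : s + 2 ≤ 2 * m) :
    (runSlot m t s).Compares (runSlot m t (s + 2)) (t + 1) := by
  refine ⟨?_, ?_, ?_, ⟨hs₀, rfl⟩, Nat.succ_ne_zero _, rfl⟩ <;> simp only [runSlot] <;>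
    split_ifs <;> omega

lemma mask_runSlot_subsingleton (t s : ℕ) : (runSlot m t s).mask.Subsingleton :=
  fun _ hσ _ hσ' => hσ.2.trans hσ'.2.symm

lemma stable_pathSlot (j τ : ℕ) (hj : (pathSlot m E j).kind = .second)
    (hj₁ : (pathSlot m E (j + 1)).kind = .first)
    (h : (pathSlot m E j).Compares (pathSlot m E (j + 2)) τ)
    (hj₃ : (pathSlot m E (j + 3)).kind = .first) :
    (pathSlot m E (j + 5)).kind = .single ∨ j + 2 ≠ E ∧ (pathSlot m E (j + 2)).mask.Subsingleton ∧
      (pathSlot m E (j + 2)).Compares (pathSlot m E (j + 4)) τ := by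
  obtain hj' | ⟨y, hy, rfl⟩ | ⟨t, s, hs, rfl⟩ := pendant_or_bridge_or_run m E j
  · rw [pathSlot_pendant hj'] at hj
    cases hj
  · rw [pathSlot_bridge hy rfl] at hj h
    have hy₀ := kind_bridgeSlot_eq_second.1 hj
    exact (stable_bridge (le_of_kind_pathSlot_bridge hy hy₀ hj₁) hy₀ hj₃ h.mem_left
      h.mem_right).imp_right fun h => ⟨by omega, h⟩
  have hstart := le_runStart m E t
  rw [pathSlot_run hs rfl] at hj h
  obtain ⟨hs₀, hs₂⟩ := kind_runSlot_eq_second.1 hj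
  obtain rfl : τ = t + 1 := h.mem_left.2
  have hs₄ : s + 4 ≤ 2 * m := by
    by_contra hlt
    obtain rfl | hs₁ : s = 2 * m ∨ s + 2 = 2 * m := by omega
    · rw [kind_pathSlot_of_eq_runStart (runStart_succ t).symm] at hj₁
      cases hj₁
    · rw [kind_pathSlot_of_eq_runStart (t := t + 1) (by rw [runStart_succ]; omega)] at hj₃
      cases hj₃
  rw [pathSlot_run (s := s + 2) (by omega) (add_assoc ..), pathSlot_run hs₄ (add_assoc ..)]
  exact .inr ⟨by omega, mask_runSlot_subsingleton t _, runSlot_compares_add_two (by omega) hs₄⟩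

/-- The layout of words with `D + 1` digits, after `E` pendant positions. -/
def pathLayout (m D : ℕ) (hE : 0 < E) : Layout (runStart m E D + 1) (D + 1) m where
  slot := pathSlot m E
  a := E
  b := E + 2 * m + 3
  a_lt := by
    have := le_runStart m E D
    omega
  b_lt := by
    have := le_runStart m E D
    omega
  kind_zero := by
    rw [pathSlot_pendant hE]
    rfl
  kind_last := kind_pathSlot_of_eq_runStart rfl
  kind_left t ht := by
    rw [pathSlot_bridge (by omega) rfl, kind_bridgeSlot_eq_first]
    omega
  kind_right t ht := by
    rw [pathSlot_bridge (y := 2 * m + 3 + 2 * t) (by omega) (by omega), kind_bridgeSlot_eq_second]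
    omega
  kind_right_hub := kind_pathSlot_of_eq_runStart (t := 0) (by rw [runStart_zero]; omega)
  second_succ_iff := kind_pathSlot_succ_eq_second_iff
  mask_single := mask_pathSlot_of_single
  height_left t ht := by
    rw [pathSlot_bridge (by omega) rfl]
    simp only [bridgeSlot]
    omega
  height_right t ht := by
    rw [pathSlot_bridge (y := 2 * m + 3 + 2 * t) (by omega) (by omega)]
    simp only [bridgeSlot]
    omega
  mem_mask_left t ht τ _ := by
    rw [pathSlot_bridge (by omega) rfl]
    exact ⟨by omega, by omega, by omega⟩
  mem_mask_right t ht τ _ := by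
    rw [pathSlot_bridge (y := 2 * m + 3 + 2 * t) (by omega) (by omega)]
    exact ⟨by omega, by omega, by omega⟩
  exists_slot z hz τ hτ := by
    obtain ⟨p, hp, h⟩ := exists_pathSlot (m := m) (E := E) hz hτ
    exact ⟨p, Nat.lt_succ_iff.2 hp, h⟩
  not_compares_succ := not_compares_pathSlot_succ
  guarded := single_of_compares_pathSlot
  stable := stable_pathSlot

lemma isPotential_pathLayout (D : ℕ) (hE : 0 < E) :
    (pathLayout m D hE).IsPotential fun z => 2 * (z / 2) := by
  have hstep : ∀ p,
      2 * ((pathSlot m E p).height / 2) ≤ 2 * ((pathSlot m E (p + 1)).height / 2) + 2 ∧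
      2 * ((pathSlot m E (p + 1)).height / 2) ≤ 2 * ((pathSlot m E p).height / 2) + 2 := by
    refine pathSlot_succ_induction (C := fun S T =>
      2 * (S.height / 2) ≤ 2 * (T.height / 2) + 2 ∧ 2 * (T.height / 2) ≤ 2 * (S.height / 2) + 2)
      (by simp) (by simp [pendantSlot, bridgeSlot]) (fun y hy => ?_) ?_ (fun t s hs => ?_)
      fun t => ?_
    · simp only [bridgeSlot]
      omega
    · simp only [bridgeSlot, runSlot, Nat.zero_mod, zero_ne_one, if_false]
      omega
    · simp only [runSlot]
      rcases Nat.mod_two_eq_zero_or_one s with h | h <;> split_ifs <;> omega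
    · simp only [runSlot]
      split_ifs <;> omega
  exact ⟨by omega, by omega, fun z => by omega, fun p _ => (hstep p).1, fun p _ => (hstep p).2⟩

lemma mask_pathSlot_subsingleton {p : ℕ} (h₀ : 2 ≤ (pathSlot m E p).height)
    (h₁ : (pathSlot m E p).height < 2 * m + 2) : (pathSlot m E p).mask.Subsingleton := by
  obtain hp | ⟨y, hy, rfl⟩ | ⟨t, s, hs, rfl⟩ := pendant_or_bridge_or_run m E p
  · rw [pathSlot_pendant hp]
    exact Set.subsingleton_empty
  · rw [pathSlot_bridge hy rfl] at h₀ h₁ ⊢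
    simp only [bridgeSlot] at h₀ h₁
    rintro σ ⟨-, -, hσ⟩ σ' ⟨-, -, hσ'⟩
    omega
  · rw [pathSlot_run hs rfl]
    exact mask_runSlot_subsingleton t s

lemma height_pathSlot_of_le {p : ℕ} (hp : p ≤ runStart m E 0) :
    (pathSlot m E p).height = min (p - (E + 1)) (2 * m + 3) := by
  rw [runStart_zero] at hp
  obtain hp' | hp' | hp' : p < E ∨ (E ≤ p ∧ p ≤ E + (2 * m + 5)) ∨ p = runStart m E 0 + 0 := by
    rw [runStart_zero]
    omega
  · rw [pathSlot_pendant hp']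
    simp only [pendantSlot]
    omega
  · rw [pathSlot_bridge (y := p - E) (by omega) (by omega)]
    simp only [bridgeSlot]
    omega
  · rw [pathSlot_run (Nat.zero_le _) hp', hp', runStart_zero]
    simp only [runSlot, Nat.zero_mod, zero_ne_one, if_false]
    omega

/-- Without runs the heights along the path change by at most one at a time, so that a single height
counts as half a layer. -/
lemma isPotential_pathLayout_zero (hE : 0 < E) : (pathLayout m 0 hE).IsPotential id where
  zero := rfl
  one_le := one_le_two
  add_two _ := rfl
  le_succ p hp := by
    simp only [id, pathLayout]
    rw [height_pathSlot_of_le (by omega), height_pathSlot_of_le (by omega)]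
    omega
  succ_le p hp := by
    simp only [id, pathLayout]
    rw [height_pathSlot_of_le (by omega), height_pathSlot_of_le (by omega)]
    omega

lemma card_words_sq_le_of_hasPLS {k d ℓ n M s q : ℕ} (hℓ : 1 ≤ ℓ) (hd : 1 ≤ d)
    (hk : d = 1 ∧ 4 * ℓ + 6 ≤ k ∨ 4 * d * ℓ + d + 7 ≤ k) (hq : q ≠ 0) (hn : k * q ^ d ≤ n)
    (hM : n ≤ M) (h : HasPLS (fun _ G => PathFree k G) ℓ n M s) :
    (q ^ d) ^ 2 ≤ s * (k * q) := by
  have : NeZero q := ⟨hq⟩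
  rw [← Fintype.card_fin q] at hn ⊢
  obtain ⟨rfl, hk⟩ | hk := hk
  · obtain ⟨E, hE, rfl⟩ : ∃ E, 0 < E ∧ k = runStart (2 * ℓ - 1) E 0 + 1 :=
      ⟨k - 4 * ℓ - 5, by omega, by rw [runStart_zero]; omega⟩
    exact (isPotential_pathLayout_zero hE).card_words_sq_le
      (fun _ _ _ _ _ _ _ => Subsingleton.elim (α := Fin 1) _ _) (by simp only [id]; omega) hn hM h
  · obtain ⟨D, rfl⟩ := Nat.exists_eq_add_of_le' hd
    obtain ⟨E, hE, rfl⟩ : ∃ E, 0 < E ∧ k = runStart (2 * ℓ) E D + 1 := by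
      have : 4 * (D + 1) * ℓ = 4 * ℓ + D * (2 * (2 * ℓ)) := by ring
      exact ⟨k - (7 + 2 * (2 * ℓ) + D * (2 * (2 * ℓ) + 1)), by rw [mul_add, mul_one]; omega,
        by rw [runStart, mul_add D, mul_one]; omega⟩
    exact (isPotential_pathLayout D hE).card_words_sq_le
      (fun p h₀ h₁ _ hσ _ hσ' => Fin.ext (mask_pathSlot_subsingleton (p := p)
        (by simp only [pathLayout] at h₀; omega) (by simp only [pathLayout] at h₁; omega) hσ hσ'))
      (by omega) hn hM h

end PathLayout

lemma exists_mul_pow_le_and_rpow_le {d k n : ℕ} (hd : d ≠ 0) (hk : k ≠ 0) (hkn : k ≤ n) :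
    ∃ q ≠ 0, k * q ^ d ≤ n ∧ ((n : ℝ) / k) ^ (1 / (d : ℝ)) ≤ 2 * q := by
  have hk₀ : (0 : ℝ) < k := by positivity
  set z : ℝ := ((n : ℝ) / k) ^ (1 / (d : ℝ)) with hz
  have hz₁ : 1 ≤ z := Real.one_le_rpow ((one_le_div hk₀).2 (by exact_mod_cast hkn)) (by positivity)
  have hzd : z ^ d = n / k := by
    rw [hz, ← Real.rpow_mul_natCast (by positivity), one_div_mul_cancel (by positivity),
      Real.rpow_one]
  refine ⟨⌊z⌋₊, (Nat.floor_pos.2 hz₁).ne', ?_, ?_⟩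
  · have : (k : ℝ) * ⌊z⌋₊ ^ d ≤ n := by
      rw [← le_div_iff₀' hk₀, ← hzd]
      gcongr
      exact Nat.floor_le (by positivity)
    exact_mod_cast this
  · have : (1 : ℝ) ≤ ⌊z⌋₊ := by exact_mod_cast Nat.floor_pos.2 hz₁
    linarith [Nat.lt_floor_add_one z]

lemma inv_mul_rpow_le_of_forall_pow_sq_le {d k n s : ℕ} (hd : 1 ≤ d) (hk : k ≠ 0) (hkn : k ≤ n)
    (h : ∀ q ≠ 0, k * q ^ d ≤ n → (q ^ d) ^ 2 ≤ s * (k * q)) :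
    (2 ^ (2 * d - 1) * k * (k : ℝ) ^ (2 - 1 / (d : ℝ)))⁻¹ * (n : ℝ) ^ (2 - 1 / (d : ℝ)) ≤ s := by
  have hk₀ : (0 : ℝ) < k := by positivity
  obtain ⟨q, hq, hqn, hzq⟩ := exists_mul_pow_le_and_rpow_le (by omega : d ≠ 0) hk hkn
  have hqpow : q ^ (2 * d - 1) ≤ s * k := by
    refine Nat.le_of_mul_le_mul_right ?_ (Nat.pos_of_ne_zero hq)
    rw [← pow_succ, mul_assoc, Nat.sub_add_cancel (by omega), mul_comm 2, pow_mul]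
    exact h q hq hqn
  have hroot : (n : ℝ) ^ (2 - 1 / (d : ℝ)) / (k : ℝ) ^ (2 - 1 / (d : ℝ)) =
      (((n : ℝ) / k) ^ (1 / (d : ℝ))) ^ (2 * d - 1) := by
    rw [← Real.rpow_mul_natCast (by positivity), ← Real.div_rpow (by positivity) hk₀.le,
      Nat.cast_sub (by omega)]
    congr 1
    push_cast
    field_simp
  rw [inv_mul_le_iff₀ (by positivity), mul_right_comm, ← div_le_iff₀ (by positivity), hroot]
  calc (((n : ℝ) / k) ^ (1 / (d : ℝ))) ^ (2 * d - 1) ≤ (2 * q) ^ (2 * d - 1) := by gcongr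
    _ = 2 ^ (2 * d - 1) * ((q ^ (2 * d - 1) : ℕ) : ℝ) := by rw [mul_pow, Nat.cast_pow]
    _ ≤ 2 ^ (2 * d - 1) * ((s * k : ℕ) : ℝ) := by gcongr
    _ = 2 ^ (2 * d - 1) * k * s := by
        push_cast
        ring

theorem mainTheorem5_general (ℓ d k : ℕ) (hℓ : 1 ≤ ℓ) (hd : 1 ≤ d)
    (hk : d = 1 ∧ 4 * ℓ + 6 ≤ k ∨ 4 * d * ℓ + d + 7 ≤ k) :
    ∃ C : ℝ, 0 < C ∧ ∀ n M s : ℕ, k ≤ n → n ≤ M → HasPLS (fun _ G => PathFree k G) ℓ n M s →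
      C * (n : ℝ) ^ (2 - 1 / (d : ℝ)) ≤ s := by
  have hk₀ : k ≠ 0 := by omega
  refine ⟨(2 ^ (2 * d - 1) * k * (k : ℝ) ^ (2 - 1 / (d : ℝ)))⁻¹, by positivity,
    fun n M s hkn hM h => ?_⟩
  exact inv_mul_rpow_le_of_forall_pow_sq_le hd hk₀ hkn fun q hq hqn =>
    card_words_sq_le_of_hasPLS hℓ hd hk hq hqn hM h

lemma requiresCertificateSize_pathFree {ℓ d k : ℕ} (hℓ : 1 ≤ ℓ) (hd : 1 ≤ d)
    (hk : d = 1 ∧ 4 * ℓ + 6 ≤ k ∨ 4 * d * ℓ + d + 7 ≤ k) :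
    RequiresCertificateSize (fun _ G => PathFree k G) ℓ fun n => (n : ℝ) ^ (2 - 1 / (d : ℝ)) := by
  obtain ⟨C, hC, h⟩ := mainTheorem5_general ℓ d k hℓ hd hk
  refine ⟨C, hC, 0, (Filter.eventually_ge_atTop k).mono fun n hkn M hM s hs => ?_⟩
  rw [pow_zero, div_one]
  exact h n M s hkn hM hs

theorem mainTheorem5 (ℓ d k : ℕ) (hℓ : 1 ≤ ℓ) (hd : 1 ≤ d) :
    (d ≤ 2 → 4 * d * ℓ + 7 * d ≤ k →
      RequiresCertificateSize (fun _ G => PathFree k G) ℓ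
        (fun n => (n : ℝ) ^ (2 - 1 / (d : ℝ)))) ∧
    (3 ≤ d → 4 * d * ℓ + 4 * d ≤ k →
      RequiresCertificateSize (fun _ G => PathFree k G) ℓ
        (fun n => (n : ℝ) ^ (2 - 1 / (d : ℝ)))) :=
  ⟨fun hd₂ hk => requiresCertificateSize_pathFree hℓ hd (by interval_cases d <;> omega),
    fun hd₃ hk => requiresCertificateSize_pathFree hℓ hd (by omega)⟩
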